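/- Let $\mathbb X,\mathbb Z,\mathbb Y_1,\dots,\mathbb Y_s$ ($s\ge 1$) be finite-dimensional real Hilbert spaces and let $\mathbb Y=\mathbb Y_1\times\dots\times\mathbb Y_s$ carry the product inner product. Consider $$\min_{y\in\mathbb Y,\,z\in\mathbb Z}\{\,p(y_1)+f(y)-\langle b,z\rangle \;:\; \mathcal F^*y+\mathcal G^*z=c\,\},\qquad (P)$$ where $p:\mathbb Y_1\to(-\infty,+\infty]$ is closed proper convex, $f:\mathbb Y\to\mathbb R$ is convex and continuously differentiable with Lipschitz gradient, $\mathcal F=(\mathcal F_1;\dots;\mathcal F_s):\mathbb X\to\mathbb Y$ and $\mathcal G:\mathbb X\to\mathbb Z$ are linear, $b\in\mathbb Z$ and $c\in\mathbb X$. Let $\mathbf K\subset\mathbb X\times\mathbb Y\times\mathbb Z$ be the set of solutions $(x,y,z)$ of the KKT system $$0\in(\partial p(y_1);0)+\nabla f(y)+\mathcal Fx,\quad \mathcal Gx=b,\quad \mathcal F^*y+\mathcal G^*z=c .$$ The dual of $(P)$ is the problem of maximizing over $x\in\mathbb X$ the function $\inf_{y,z}\{p(y_1)+f(y)-\langle b,z\rangle+\langle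 x,\mathcal F^*y+\mathcal G^*z-c\rangle\}$. Let $\widehat\Sigma$ be a self-adjoint positive semidefinite operator on $\mathbb Y$, with blocks $\widehat\Sigma_{ij}$, such that $f(y)\le \hat f(y,y'):=f(y')+\langle\nabla f(y'),y-y'\rangle+\tfrac12\langle y-y',\widehat\Sigma(y-y')\rangle$ for all $y,y'\in\mathbb Y$. For $\sigma>0$ put $$\mathcal L_\sigma(y,z;(x,y'))=p(y_1)+\hat f(y,y')-\langle b,z\rangle+\langle\mathcal F^*y+\mathcal G^*z-c,x\rangle+\tfrac\sigma2\|\mathcal F^*y+\mathcal G^*z-c\|^2 .$$ Let $\mathcal D_i$ be self-adjoint operators on $\mathbb Y_i$ with $$\tfrac12\widehat\Sigma_{ii}+\sigma\mathcal F_i\mathcal F_i^*+\mathcal D_i\succ0\ (i=1,\dots,s),\qquad \mathrm{diag}(\mathcal D_1,\dots,\mathcal D_s)\succeq-\tfrac12\widehat\Sigma .$$ Algorithm sGS-iPADMM: let $\tau\in(0,2)$, let $(\varepsilon_k)_{k\ge0}$ be nonnegative and summable, and let $(x^0,y^0,z^0)\in\mathbb X\times\mathbb Y\times\mathbb Z$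 with $p(y_1^0)<+\infty$. For $k=0,1,\dots$: 1. for $i=s,\dots,2$ find $y_i^{k+1/2}$ such that some $\tilde\delta_i^k$ with $\|\tilde\delta_i^k\|\le\varepsilon_k$ satisfies $\tilde\delta_i^k\in\partial_{y_i}\mathcal L_\sigma((y^k_{<i};y_i^{k+1/2};y^{k+1/2}_{>i}),z^k;(x^k,y^k))+\mathcal D_i(y_i^{k+1/2}-y_i^k)$; 2. for $i=1,\dots,s$ find $y_i^{k+1}$ such that some $\delta_i^k$ with $\|\delta_i^k\|\le\varepsilon_k$ satisfies $\delta_i^k\in\partial_{y_i}\mathcal L_\sigma((y^{k+1}_{<i};y_i^{k+1};y^{k+1/2}_{>i}),z^k;(x^k,y^k))+\mathcal D_i(y_i^{k+1}-y_i^k)$; 3. find $z^{k+1}$ with $\|\mathcal Gx^k-b+\sigma\mathcal G(\mathcal F^*y^{k+1}+\mathcal G^*z^{k+1}-c)\|\le\varepsilon_k$; 4. put $x^{k+1}=x^k+\tau\sigma(\mathcal F^*y^{k+1}+\mathcal G^*z^{k+1}-c)$. **Theorem.** Suppose $\mathbf K\neq\emptyset$ and let $(x^k,y^k,z^k)$ be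 any sequence generated by this algorithm. Let $\Pi$ be the orthogonal projection of $\mathbb Z$ onto $\mathrm{Range}(\mathcal G)$. (a) $(x^k,y^k,\Pi z^k)$ converges to some $(x^*,y^*,z^*)\in\mathbf K$; in particular $(y^*,z^*)$ is an optimal solution of $(P)$ and $x^*$ is an optimal solution of its dual. (b) Every accumulation point of $(y^k,z^k)$ is an optimal solution of $(P)$. (c) $p(y_1^k)+f(y^k)-\langle b,z^k\rangle$ converges to the optimal value of $(P)$, and $\mathcal F^*y^k+\mathcal G^*z^k-c\to0$. (d) $\mathrm{dist}((x^k,y^k,z^k),\mathbf K)\to0$. (e) If $\mathcal G$ is surjective, then $(x^k,y^k,z^k)$ converges to a point of $\mathbf K$. **Two-block case.** Let $s=1$ and $f=0$, let $\sigma>0$, $\tau\in(0,2)$ and $\mathbf K\ne\emptyset$, and suppose that $\mathcal F$ is surjective or $p$ is strongly convex. Let $(x^k,y^k,z^k)$ be generated by the classic ADMM, that is, with $L_\sigma(y,z;x)=p(y)-\langle b,z\rangle+\langle x,\mathcal F^*y+\mathcal G^*z-c\rangle+\frac\sigma2\|\mathcal F^*y+\mathcal G^*z-c\|^2$, $$y^{k+1}\in\arg\min_yL_\sigma(y,z^k;x^k),\quad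 z^{k+1}\in\arg\min_zL_\sigma(y^{k+1},z;x^k),\quad x^{k+1}=x^k+\tau\sigma(\mathcal F^*y^{k+1}+\mathcal G^*z^{k+1}-c),$$ or by its inexact variant, that is, by the algorithm above with $\widehat\Sigma=0$ and $\mathcal D_1=0$. Then $(x^k,y^k,\Pi z^k)$ converges to a point $(x^*,y^*,z^*)$ of $\mathbf K$, where $(y^*,z^*)$ solves $(P)$ and $x^*$ solves its dual, and $\mathrm{dist}((x^k,y^k,z^k),\mathbf K)\to0$. If moreover $\mathcal G$ is surjective, then $(x^k,y^k,z^k)$ converges to a point of $\mathbf K$. -/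

import Mathlib

open Filter Topology
open scoped RealInnerProductSpace NNReal Gradient

noncomputable section

namespace SGSADMM

/-! ### Convex analysis -/

section Convex

variable {E : Type*} [NormedAddCommGroup E] [InnerProductSpace ℝ E]

/-- The effective domain of a function `θ : E → (-∞, +∞]`. -/
def effDomain (θ : E → EReal) : Set E := {v | θ v ≠ ⊤}

/-- Closed proper convex functions with values in `(-∞, +∞]`. -/
structure IsClosedProperConvex (θ : E → EReal) : Prop where
  ne_bot : ∀ v, θ v ≠ ⊥
  proper : (effDomain θ).Nonempty
  closed : LowerSemicontinuous θ
  convex : ConvexOn ℝ (effDomain θ) (fun v => (θ v).toReal)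

/-- Strong convexity (with some positive modulus) of a function with values in `(-∞, +∞]`. -/
def IsStronglyConvex (θ : E → EReal) : Prop :=
  ∃ μ : ℝ, 0 < μ ∧ StrongConvexOn (effDomain θ) μ (fun v => (θ v).toReal)

/-- The subdifferential of convex analysis. -/
def subdiff (θ : E → EReal) (v : E) : Set E :=
  {g | ∀ v', θ v + ((⟪g, v' - v⟫ : ℝ) : EReal) ≤ θ v'}

/-- Self-adjoint positive definite operators. -/
def IsPosDef (A : E →ₗ[ℝ] E) : Prop :=
  A.IsSymmetric ∧ ∀ v, v ≠ 0 → 0 < ⟪A v, v⟫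

end Convex

/-! ### Block vectors and block operators -/

section Blocks

variable {m : ℕ} {Y : Fin (m + 1) → Type*} [∀ i, NormedAddCommGroup (Y i)]
  [∀ i, InnerProductSpace ℝ (Y i)]

/-- The canonical inclusion of the `i`-th factor into the product Hilbert space. -/
def incl (i : Fin (m + 1)) : Y i →ₗ[ℝ] PiLp 2 Y :=
  (WithLp.linearEquiv 2 ℝ (∀ j, Y j)).symm.toLinearMap ∘ₗ LinearMap.single ℝ Y i

/-- The canonical projection of the product Hilbert space onto the `i`-th factor. -/
def proj (i : Fin (m + 1)) : PiLp 2 Y →ₗ[ℝ] Y i := PiLp.projₗ 2 Y i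

/-- The `(i, j)` block `A i j : Y j → Y i` of an operator on the product space. -/
def block (A : PiLp 2 Y →ₗ[ℝ] PiLp 2 Y) (i j : Fin (m + 1)) : Y j →ₗ[ℝ] Y i :=
  proj i ∘ₗ A ∘ₗ incl j

/-- The block-diagonal operator `diag (D 0, …, D m)`. -/
def blockDiag (D : ∀ i, Y i →ₗ[ℝ] Y i) : PiLp 2 Y →ₗ[ℝ] PiLp 2 Y :=
  ∑ i, incl i ∘ₗ D i ∘ₗ proj i

/-- The vector `(a_{<i}; v; b_{>i})`. -/
def mix (a b : PiLp 2 Y) (i : Fin (m + 1)) (v : Y i) : PiLp 2 Y :=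
  WithLp.toLp 2 (Function.update (fun j => if j < i then a j else b j) i v)

end Blocks

/-! ### The optimization problem -/

section Problem

variable {m : ℕ} {X : Type*} {Y : Fin (m + 1) → Type*} {Z : Type*}
  [NormedAddCommGroup X] [InnerProductSpace ℝ X] [FiniteDimensional ℝ X]
  [∀ i, NormedAddCommGroup (Y i)] [∀ i, InnerProductSpace ℝ (Y i)]
  [∀ i, FiniteDimensional ℝ (Y i)]
  [NormedAddCommGroup Z] [InnerProductSpace ℝ Z] [FiniteDimensional ℝ Z]

variable (X Y Z) in
/-- The data of the multi-block convex composite problem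
`min { p (y_1) + f y - ⟪b, z⟫ | F* y + G* z = c }`. There are `m + 1` blocks, numbered from `0`, so
that the nonsmooth term acts on the block with index `0`. -/
structure Problem where
  p : Y 0 → EReal
  f : PiLp 2 Y → ℝ
  b : Z
  c : X
  F : X →ₗ[ℝ] PiLp 2 Y
  G : X →ₗ[ℝ] Z
  p_closedProperConvex : IsClosedProperConvex p
  f_convex : ConvexOn ℝ Set.univ f
  f_contDiff : ContDiff ℝ 1 f
  f_lipschitz : ∃ K : ℝ≥0, LipschitzWith K (∇ f)

namespace Problem

variable (P : Problem X Y Z)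

/-- The component `F i : X → Y i` of `F`. -/
def Fblock (i : Fin (m + 1)) : X →ₗ[ℝ] Y i := proj i ∘ₗ P.F

/-- The constraint residual `F* y + G* z - c`. -/
def residual (y : PiLp 2 Y) (z : Z) : X :=
  LinearMap.adjoint P.F y + LinearMap.adjoint P.G z - P.c

/-- The objective function `p (y_1) + f y - ⟪b, z⟫`. -/
def objective (y : PiLp 2 Y) (z : Z) : EReal :=
  P.p (y 0) + ((P.f y - ⟪P.b, z⟫ : ℝ) : EReal)

/-- The (global) optimal solutions of the problem. -/
def IsSolution (y : PiLp 2 Y) (z : Z) : Prop :=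
  P.residual y z = 0 ∧ ∀ y' z', P.residual y' z' = 0 → P.objective y z ≤ P.objective y' z'

/-- The optimal value of the problem. -/
def optValue : EReal :=
  ⨅ (y : PiLp 2 Y) (z : Z) (_ : P.residual y z = 0), P.objective y z

/-- The Lagrangian function. -/
def lagrangian (y : PiLp 2 Y) (z : Z) (x : X) : EReal :=
  P.p (y 0) + ((P.f y - ⟪P.b, z⟫ + ⟪x, P.residual y z⟫ : ℝ) : EReal)

/-- The objective function of the dual problem (a maximization problem over `X`). -/
def dualFunction (x : X) : EReal := ⨅ (y : PiLp 2 Y) (z : Z), P.lagrangian y z x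

/-- The optimal solutions of the dual problem. -/
def IsDualSolution (x : X) : Prop := ∀ x', P.dualFunction x' ≤ P.dualFunction x

/-- The KKT system
`0 ∈ (∂p (y_1); 0) + ∇f y + F x`, `G x - b = 0`, `F* y + G* z = c`. -/
def IsKKT (x : X) (y : PiLp 2 Y) (z : Z) : Prop :=
  (∃ g ∈ subdiff P.p (y 0), incl 0 g + ∇ P.f y + P.F x = 0) ∧
    P.G x - P.b = 0 ∧ LinearMap.adjoint P.F y + LinearMap.adjoint P.G z = P.c

variable (X Y Z) in
/-- The product Hilbert space `X × Y × Z`. -/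
abbrev Triple := WithLp 2 (X × WithLp 2 (PiLp 2 Y × Z))

/-- The element `(x, y, z)` of the product Hilbert space. -/
def triple (x : X) (y : PiLp 2 Y) (z : Z) : Triple X Y Z :=
  WithLp.toLp 2 (x, WithLp.toLp 2 (y, z))

/-- The solution set of the KKT system. -/
def kktSet : Set (Triple X Y Z) := {u | ∃ x y z, u = triple x y z ∧ P.IsKKT x y z}

/-! ### The majorized augmented Lagrangian function -/

/-- The quadratic model of `f` at `y'` with curvature `S`. -/
def fHat (S : PiLp 2 Y →ₗ[ℝ] PiLp 2 Y) (y y' : PiLp 2 Y) : ℝ :=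
  P.f y' + ⟪∇ P.f y', y - y'⟫ + 1 / 2 * ⟪y - y', S (y - y')⟫

/-- `S` is self-adjoint and positive semidefinite, and the quadratic models with curvature `S`
majorize `f`. -/
def IsMajorizing (S : PiLp 2 Y →ₗ[ℝ] PiLp 2 Y) : Prop :=
  S.IsPositive ∧ ∀ y y', P.f y ≤ P.fHat S y y'

/-- The majorized augmented Lagrangian function `L_σ(y, z; (x, y'))`. -/
def majAugLagrangian (S : PiLp 2 Y →ₗ[ℝ] PiLp 2 Y) (σ : ℝ) (y : PiLp 2 Y) (z : Z) (x : X)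
    (y' : PiLp 2 Y) : EReal :=
  P.p (y 0) + ((P.fHat S y y' - ⟪P.b, z⟫ + ⟪P.residual y z, x⟫
    + σ / 2 * ‖P.residual y z‖ ^ 2 : ℝ) : EReal)

/-- The (unmajorized) augmented Lagrangian function `L_σ(y, z; x)`. -/
def augLagrangian (σ : ℝ) (y : PiLp 2 Y) (z : Z) (x : X) : EReal :=
  P.p (y 0) + ((P.f y - ⟪P.b, z⟫ + ⟪x, P.residual y z⟫
    + σ / 2 * ‖P.residual y z‖ ^ 2 : ℝ) : EReal)

/-- The conditions on the (possibly indefinite) proximal terms: the `D i` are self-adjoint,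
`1/2 S_ii + σ F_i F_i* + D_i ≻ 0` for all `i`, and `diag (D_1, …, D_s) ⪰ - 1/2 S`. -/
structure ProximalCondition (S : PiLp 2 Y →ₗ[ℝ] PiLp 2 Y) (D : ∀ i, Y i →ₗ[ℝ] Y i) (σ : ℝ) :
    Prop where
  symm : ∀ i, (D i).IsSymmetric
  posDef : ∀ i, IsPosDef ((1 / 2 : ℝ) • block S i i
    + σ • (P.Fblock i ∘ₗ LinearMap.adjoint (P.Fblock i)) + D i)
  lower : (blockDiag D - (-(1 / 2 : ℝ)) • S).IsPositive

/-! ### The algorithms -/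

/-- `(x k, y k, z k)` is a sequence generated by the inexact block symmetric Gauss-Seidel based
indefinite-proximal ADMM with tolerances `ε k`; `yh k` holds the intermediate blocks
`y_i^{k+1/2}` for `i ≠ 0` (its block `0` is never used). -/
structure IsSGSiPADMM (S : PiLp 2 Y →ₗ[ℝ] PiLp 2 Y) (D : ∀ i, Y i →ₗ[ℝ] Y i) (σ τ : ℝ)
    (ε : ℕ → ℝ) (x : ℕ → X) (y yh : ℕ → PiLp 2 Y) (z : ℕ → Z) : Prop where
  tol_nonneg : ∀ k, 0 ≤ ε k
  tol_summable : Summable ε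
  init : y 0 0 ∈ effDomain P.p
  /-- Backward sweep over the blocks `i ≠ 0`. -/
  step1 : ∀ k i, i ≠ 0 → ∃ δ : Y i, ‖δ‖ ≤ ε k ∧
    δ - D i (yh k i - y k i) ∈
      subdiff (fun v => P.majAugLagrangian S σ (mix (y k) (yh k) i v) (z k) (x k) (y k)) (yh k i)
  /-- Forward sweep over all blocks. -/
  step2 : ∀ k i, ∃ δ : Y i, ‖δ‖ ≤ ε k ∧
    δ - D i (y (k + 1) i - y k i) ∈
      subdiff (fun v => P.majAugLagrangian S σ (mix (y (k + 1)) (yh k) i v) (z k) (x k) (y k))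
        (y (k + 1) i)
  step3 : ∀ k, ‖P.G (x k) - P.b + σ • P.G (P.residual (y (k + 1)) (z (k + 1)))‖ ≤ ε k
  step4 : ∀ k, x (k + 1) = x k + (τ * σ) • P.residual (y (k + 1)) (z (k + 1))

/-- `(x k, y k, z k)` is a sequence generated by the classic ADMM, in the order `y`, `z`, `x`, with
exact minimization of the augmented Lagrangian function. -/
structure IsClassicADMM (σ τ : ℝ) (x : ℕ → X) (y : ℕ → PiLp 2 Y) (z : ℕ → Z) : Prop where
  step_y : ∀ k v, P.augLagrangian σ (y (k + 1)) (z k) (x k) ≤ P.augLagrangian σ v (z k) (x k)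
  step_z : ∀ k w, P.augLagrangian σ (y (k + 1)) (z (k + 1)) (x k) ≤
    P.augLagrangian σ (y (k + 1)) w (x k)
  step_x : ∀ k, x (k + 1) = x k + (τ * σ) • P.residual (y (k + 1)) (z (k + 1))

/-- The orthogonal projection of `Z` onto the range of `G`. -/
def projRange (w : Z) : Z := (LinearMap.range P.G).starProjection w

end Problem

end Problem

end SGSADMM

end

set_option linter.unusedSectionVars false

noncomputable section

namespace SGSADMM

/-! ### Convex analysis: subdifferentials, gradients and monotonicity. -/

section ConvexLemmas

variable {E : Type*} [NormedAddCommGroup E] [InnerProductSpace ℝ E]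

/-! The proof removes first the sweeps over the blocks and then the variable `z`. What remains is an
inexact proximal augmented Lagrangian method in `y` alone, which is quasi-Fejér monotone.

Sweeps. Let `K = S + σ F F*`, with strict block triangular parts `L` and `U`, and let `B` hold the
inverses of the diagonal blocks of `K + diag D`. Subtracting the optimality conditions of the
backward and forward sweeps expresses the intermediate point through the new one. The two sweeps
thus become one simultaneous update with proximal operator `N = S + diag D + U B L` and summable
error (`IsSGSiPADMM.isInexactProxADMM`). The proximal condition makes `N - S/2` nonnegative, and
positive definite after adding `σ F F*` (`ProximalCondition.sgsProx_pos`).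

Elimination of `z`. The `z`- and `x`-steps give `G x⁺ - b = (1 - τ)(G x - b) + O(ε)` with `|1 - τ| <
1`, so `G x - b` and `G r`, with `r` the constraint residual, are summable. Let `Q` project onto
`ker G`. Since `Q G* = 0`, the component `Q r = Q F* y - Q c` is free of `z`, and everything outside
`ker G` is a fixed vector or a summable error. Hence `(y, Q x)` follows a proximal augmented
Lagrangian method with constraint map `Q F*` and proximal operator `N + σ F (1 - Q) F*`
(`IsInexactProxADMM.isInexactProxALM`). This is why every `τ < 2` is allowed.

Convergence. Monotonicity of `∂p`, together with a co-coercivity estimate that charges the use of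
the old gradient to `S/2`, yields a Lyapunov function that decreases up to summable errors
(`IsInexactProxALM.fejer`). Cluster points are saddle points, and the Lyapunov function centred at
one of them tends to zero (`IsInexactProxALM.tendsto_saddle`). Then `x` is recovered from `Q x` and
`G x → b`, and `Π z` from the convergence of `G* z`.

In the two-block case `N = 0`; definiteness comes from `F F*` or from the modulus `μ` of strong
convexity, which is carried through the argument for this purpose. -/

theorem le_of_forall_le_add_mul {a b c : ℝ} (h : ∀ t : ℝ, 0 < t → t < 1 → a ≤ b + t * c) :
    a ≤ b := by
  have h1 : Tendsto (fun t : ℝ => b + t * c) (𝓝[>] 0) (𝓝 (b + 0 * c)) :=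
    ((continuous_const.add (continuous_id.mul continuous_const)).tendsto 0).mono_left
      nhdsWithin_le_nhds
  have h2 : ∀ᶠ t : ℝ in 𝓝[>] 0, a ≤ b + t * c := by
    filter_upwards [Ioo_mem_nhdsGT (zero_lt_one (α := ℝ))] with t ht using h t ht.1 ht.2
  simpa using ge_of_tendsto h1 h2

theorem coe_toReal_of_mem_effDomain {E : Type*} {θ : E → EReal} (hb : ∀ v, θ v ≠ ⊥) {v : E}
    (hv : v ∈ effDomain θ) : (((θ v).toReal : ℝ) : EReal) = θ v :=
  EReal.coe_toReal hv (hb v)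

theorem mem_effDomain_of_mem_subdiff {θ : E → EReal} (hp : (effDomain θ).Nonempty) {v g : E}
    (hg : g ∈ subdiff θ v) : v ∈ effDomain θ := by
  obtain ⟨w, hw⟩ := hp
  intro htop
  have := hg w
  rw [htop, EReal.top_add_coe, top_le_iff] at this
  exact hw this

theorem mem_subdiff_iff {θ : E → EReal} (hb : ∀ v, θ v ≠ ⊥) {v g : E} (hv : v ∈ effDomain θ) :
    g ∈ subdiff θ v ↔ ∀ w ∈ effDomain θ, (θ v).toReal + ⟪g, w - v⟫ ≤ (θ w).toReal := by
  constructor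
  · intro hg w hw
    have := hg w
    rw [← coe_toReal_of_mem_effDomain hb hv, ← coe_toReal_of_mem_effDomain hb hw] at this
    exact_mod_cast this
  · intro h w
    by_cases hw : w ∈ effDomain θ
    · rw [← coe_toReal_of_mem_effDomain hb hv, ← coe_toReal_of_mem_effDomain hb hw]
      exact_mod_cast h w hw
    · have : θ w = ⊤ := by simpa [effDomain] using hw
      rw [this]
      exact le_top

theorem add_coe_mem_effDomain_iff {E : Type*} {θ : E → EReal} {h : E → ℝ} {v : E} :
    v ∈ effDomain (fun v => θ v + (h v : EReal)) ↔ v ∈ effDomain θ := by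
  change ¬ θ v + (h v : EReal) = ⊤ ↔ ¬ θ v = ⊤
  induction θ v using EReal.rec with
  | bot => simp
  | coe r => exact iff_of_true (EReal.coe_ne_top (r + h v)) (EReal.coe_ne_top r)
  | top => simp

/-- The sum rule for the subdifferential of a convex function plus a smooth function. -/
theorem sub_mem_subdiff_of_add {θ : E → EReal} (hb : ∀ v, θ v ≠ ⊥) (hp : (effDomain θ).Nonempty)
    (hc : ConvexOn ℝ (effDomain θ) (fun v => (θ v).toReal)) {h : E → ℝ} {v g l : E}
    (hh : ∀ w, ∃ c, ∀ t : ℝ, h (v + t • w) ≤ h v + t * ⟪l, w⟫ + t ^ 2 * c)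
    (hg : g ∈ subdiff (fun v => θ v + (h v : EReal)) v) : g - l ∈ subdiff θ v := by
  have hb' : ∀ v, θ v + (h v : EReal) ≠ ⊥ := fun v => by simp [EReal.add_eq_bot_iff, hb v]
  have hp' : (effDomain (fun v => θ v + (h v : EReal))).Nonempty := by
    obtain ⟨w, hw⟩ := hp
    exact ⟨w, add_coe_mem_effDomain_iff.2 hw⟩
  have hv' := mem_effDomain_of_mem_subdiff hp' hg
  have hv := add_coe_mem_effDomain_iff.1 hv'
  have htr : ∀ w ∈ effDomain θ, (θ w + (h w : EReal)).toReal = (θ w).toReal + h w := by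
    intro w hw
    rw [← coe_toReal_of_mem_effDomain hb hw, ← EReal.coe_add, EReal.toReal_coe, EReal.toReal_coe]
  rw [mem_subdiff_iff hb' hv'] at hg
  rw [mem_subdiff_iff hb hv]
  intro w hw
  obtain ⟨c, hc'⟩ := hh (w - v)
  -- The subgradient inequality is tested on the segment from `v` to `w`. After division by `t`,
  -- only `t * c` is left of the quadratic error.
  apply le_of_forall_le_add_mul (c := c)
  intro t ht0 ht1
  have hconv := hc.2 hv hw (sub_nonneg.2 ht1.le) ht0.le (by ring)
  have hmem := hc.1 hv hw (sub_nonneg.2 ht1.le) ht0.le (by ring)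
  have heq : (1 - t) • v + t • w = v + t • (w - v) := by module
  rw [heq] at hconv hmem
  have h1 := hg _ (add_coe_mem_effDomain_iff.2 hmem)
  have h2 := hc' t
  rw [htr v hv, htr _ hmem, add_sub_cancel_left, inner_smul_right] at h1
  rw [inner_sub_left]
  simp only [smul_eq_mul] at hconv
  have h3 : t * ((θ v).toReal + (⟪g, w - v⟫ - ⟪l, w - v⟫)) ≤ t * ((θ w).toReal + t * c) := by
    nlinarith
  exact le_of_mul_le_mul_left h3 ht0

/-- Strong monotonicity of the subdifferential of a strongly convex function. -/
theorem subdiff_strongly_monotone {θ : E → EReal} (hb : ∀ v, θ v ≠ ⊥)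
    (hp : (effDomain θ).Nonempty) {μ : ℝ}
    (hc : StrongConvexOn (effDomain θ) μ (fun v => (θ v).toReal)) {v g v' g' : E}
    (hg : g ∈ subdiff θ v) (hg' : g' ∈ subdiff θ v') : μ * ‖v - v'‖ ^ 2 ≤ ⟪g - g', v - v'⟫ := by
  have key : ∀ {v g v' : E}, g ∈ subdiff θ v → v' ∈ effDomain θ →
      (θ v).toReal + ⟪g, v' - v⟫ + μ / 2 * ‖v - v'‖ ^ 2 ≤ (θ v').toReal := by
    intro v g w hg hw
    have hv := mem_effDomain_of_mem_subdiff hp hg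
    rw [mem_subdiff_iff hb hv] at hg
    apply le_of_forall_le_add_mul (c := μ / 2 * ‖v - w‖ ^ 2)
    intro t ht0 ht1
    have hconv := hc.2 hv hw (sub_nonneg.2 ht1.le) ht0.le (by ring)
    have hmem := hc.1 hv hw (sub_nonneg.2 ht1.le) ht0.le (by ring)
    have heq : (1 - t) • v + t • w = v + t • (w - v) := by module
    rw [heq] at hconv hmem
    have h1 := hg _ hmem
    rw [add_sub_cancel_left, inner_smul_right] at h1
    simp only [smul_eq_mul] at hconv
    have h3 : t * ((θ v).toReal + ⟪g, w - v⟫ + μ / 2 * ‖v - w‖ ^ 2)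
        ≤ t * ((θ w).toReal + t * (μ / 2 * ‖v - w‖ ^ 2)) := by
      nlinarith
    exact le_of_mul_le_mul_left h3 ht0
  have h1 := key hg (mem_effDomain_of_mem_subdiff hp hg')
  have h2 := key hg' (mem_effDomain_of_mem_subdiff hp hg)
  rw [← neg_sub v v', inner_neg_right] at h1
  rw [norm_sub_rev v' v] at h2
  rw [inner_sub_left]
  linarith

/-- The subdifferential of a lower semicontinuous function has a closed graph. -/
theorem mem_subdiff_of_tendsto {θ : E → EReal} (hb : ∀ v, θ v ≠ ⊥)
    (hl : LowerSemicontinuous θ) {ι : Type*} {l : Filter ι} [l.NeBot] {v g : ι → E} {v' g' : E}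
    (hv : Tendsto v l (𝓝 v')) (hg : Tendsto g l (𝓝 g')) (h : ∀ᶠ n in l, g n ∈ subdiff θ (v n)) :
    g' ∈ subdiff θ v' := by
  intro w
  by_cases hw : θ w = ⊤
  · rw [hw]
    exact le_top
  obtain ⟨r, hr⟩ : ∃ r : ℝ, θ w = r := ⟨_, (EReal.coe_toReal hw (hb w)).symm⟩
  have hT : Tendsto (fun n => ((r - ⟪g n, w - v n⟫ : ℝ) : EReal)) l
      (𝓝 ((r - ⟪g', w - v'⟫ : ℝ) : EReal)) :=
    (continuous_coe_real_ereal.tendsto _).comp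
      (tendsto_const_nhds.sub (hg.inner (tendsto_const_nhds.sub hv)))
  have hle : ∀ᶠ n in l, θ (v n) ≤ ((r - ⟪g n, w - v n⟫ : ℝ) : EReal) := by
    filter_upwards [h] with n hn
    have := hn w
    rw [hr] at this
    rw [EReal.coe_sub]
    exact EReal.le_sub_iff_add_le (Or.inl (EReal.coe_ne_bot _)) (Or.inl (EReal.coe_ne_top _)) |>.2 this
  have h1 : θ v' ≤ ((r - ⟪g', w - v'⟫ : ℝ) : EReal) := by
    apply le_of_forall_lt
    intro c hc
    -- Lower semicontinuity bounds `θ (v n)` below by `d`; the gap between `c` and `d` absorbs the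
    -- strictness lost in the limit.
    obtain ⟨d, hcd, hd⟩ := exists_between hc
    refine hcd.trans_le (ge_of_tendsto hT ?_)
    filter_upwards [hle, hv.eventually (hl v' d hd)] with n h1 h2 using h2.le.trans h1
  rw [hr]
  rw [EReal.coe_sub] at h1
  exact EReal.le_sub_iff_add_le (Or.inl (EReal.coe_ne_bot _)) (Or.inl (EReal.coe_ne_top _)) |>.1 h1

variable [CompleteSpace E]

theorem ConvexOn.add_inner_gradient_le {f : E → ℝ} (hf : ConvexOn ℝ Set.univ f)
    (hd : Differentiable ℝ f) (v w : E) : f v + ⟪∇ f v, w - v⟫ ≤ f w := by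
  have h1 : ConvexOn ℝ Set.univ (fun t : ℝ => f (v + t • (w - v))) := by
    have := hf.comp_affineMap (AffineMap.lineMap v w : ℝ →ᵃ[ℝ] E)
    simpa [Function.comp_def, AffineMap.lineMap_apply, add_comm] using this
  have h2 : HasDerivAt (fun t : ℝ => f (v + t • (w - v))) ⟪∇ f v, w - v⟫ 0 := by
    have h3 : HasDerivAt (fun t : ℝ => v + t • (w - v)) (w - v) 0 := by
      simpa using ((hasDerivAt_id (0 : ℝ)).smul_const (w - v)).const_add v
    have h4 := (hd v).hasGradientAt.hasFDerivAt
    have h5 : HasFDerivAt f (InnerProductSpace.toDual ℝ E (∇ f v)) (v + (0 : ℝ) • (w - v)) := by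
      simpa using h4
    exact h5.comp_hasDerivAt (0 : ℝ) h3
  have h6 := h1.le_slope_of_hasDerivAt (Set.mem_univ 0) (Set.mem_univ 1) zero_lt_one h2
  simp only [slope_def_field, one_smul, zero_smul, add_zero, add_sub_cancel, sub_zero,
    div_one] at h6
  linarith

/-- A form of co-coercivity of the gradient of a convex function with a quadratic majorant. -/
theorem neg_le_inner_gradient_sub {f : E → ℝ} {S : E →ₗ[ℝ] E} (hf : ConvexOn ℝ Set.univ f)
    (hd : Differentiable ℝ f)
    (hS : ∀ y y', f y ≤ f y' + ⟪∇ f y', y - y'⟫ + 1 / 2 * ⟪y - y', S (y - y')⟫) (u v w : E) :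
    -(1 / 4) * ⟪w - u, S (w - u)⟫ ≤ ⟪∇ f u - ∇ f v, w - v⟫ := by
  have key : ∀ u v d : E, f v + ⟪∇ f v, u - d - v⟫ ≤ f u - ⟪∇ f u, d⟫ + 1 / 2 * ⟪d, S d⟫ := by
    intro u v d
    have h1 := ConvexOn.add_inner_gradient_le hf hd v (u - d)
    have h2 := hS (u - d) u
    simp only [sub_sub_cancel_left, inner_neg_right, inner_neg_left, map_neg, neg_neg] at h2
    linarith
  -- Moving by `d` from `u` and by `-d` from `v` and adding, the linear terms contain `d` twice,
  -- that is `w - u`. The quadratic terms add up to `⟪d, S d⟫`, which is the source of the factor `1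
  -- / 4`.
  set d : E := (1 / 2 : ℝ) • (w - u) with hdef
  have h1 := key u v (-d)
  have h2 := key v u d
  have h3 : ⟪d, S d⟫ = 1 / 4 * ⟪w - u, S (w - u)⟫ := by
    simp only [hdef, map_smul, inner_smul_left, inner_smul_right, RCLike.conj_to_real]
    ring
  have h4 : ∀ g : E, ⟪g, d⟫ = 1 / 2 * (⟪g, w⟫ - ⟪g, u⟫) := by
    intro g
    simp only [hdef, inner_smul_right, inner_sub_right]
  simp only [map_neg, inner_neg_left, inner_neg_right, neg_neg, h3, inner_sub_right, h4] at h1 h2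
  simp only [inner_sub_left, inner_sub_right] at *
  linarith

end ConvexLemmas

/-! ### Perturbed monotone sequences and definite quadratic forms. -/

section Sequences

theorem sqrt_le_add_of_le_add_mul_sqrt {a b c : ℝ} (ha : 0 ≤ a) (hb : 0 ≤ b) (hc : 0 ≤ c)
    (h : b ≤ a + c * √b) : √b ≤ √a + c := by
  by_contra! hlt
  have h1 := Real.sqrt_nonneg a
  have h2 := Real.sq_sqrt ha
  have h3 := Real.sq_sqrt hb
  nlinarith [Real.sqrt_nonneg b]

/-- The errors enter multiplied by a distance, that is by the square root of the Lyapunov function,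
so it is the square root that telescopes. This gives boundedness before any summability of the full
error term is known. -/
theorem exists_bound_of_le_add_mul_sqrt {L e : ℕ → ℝ} (hL : ∀ k, 0 ≤ L k) (he : ∀ k, 0 ≤ e k)
    (hs : Summable e) (h : ∀ k, L (k + 1) ≤ L k + e k * √(L (k + 1))) :
    ∃ M, ∀ k, √(L k) ≤ M := by
  refine ⟨√(L 0) + ∑' i, e i, fun k => ?_⟩
  have h1 : ∀ k, √(L k) ≤ √(L 0) + ∑ i ∈ Finset.range k, e i := by
    intro k
    induction k with
    | zero => simp
    | succ k ih =>
      rw [Finset.sum_range_succ]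
      linarith [sqrt_le_add_of_le_add_mul_sqrt (hL k) (hL (k + 1)) (he k) (h k)]
  linarith [h1 k, hs.sum_le_tsum (Finset.range k) (fun i _ => he i)]

/-- A deterministic version of the Robbins-Siegmund lemma. -/
theorem summable_and_tendsto_of_add_le_add {L r s : ℕ → ℝ} (hL : ∀ k, 0 ≤ L k)
    (hr : ∀ k, 0 ≤ r k) (hs0 : ∀ k, 0 ≤ s k) (hs : Summable s)
    (h : ∀ k, L (k + 1) + r k ≤ L k + s k) :
    Summable r ∧ ∃ l, Tendsto L atTop (𝓝 l) := by
  have h1 : ∀ n, L n + ∑ i ∈ Finset.range n, r i ≤ L 0 + ∑ i ∈ Finset.range n, s i := by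
    intro n
    induction n with
    | zero => simp
    | succ n ih =>
      rw [Finset.sum_range_succ, Finset.sum_range_succ]
      linarith [h n]
  have h2 : ∀ n, ∑ i ∈ Finset.range n, s i ≤ ∑' i, s i :=
    fun n => hs.sum_le_tsum _ (fun i _ => hs0 i)
  refine ⟨summable_of_sum_range_le (c := L 0 + ∑' i, s i) hr
    (fun n => by linarith [h1 n, h2 n, hL n]), ?_⟩
  have hanti : Antitone (fun k => L k - ∑ i ∈ Finset.range k, s i) := by
    apply antitone_nat_of_succ_le
    intro n
    rw [Finset.sum_range_succ]
    linarith [h n, hr n]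
  have hbdd : BddBelow (Set.range (fun k => L k - ∑ i ∈ Finset.range k, s i)) :=
    ⟨-∑' i, s i, by rintro _ ⟨n, rfl⟩; linarith [hL n, h2 n]⟩
  refine ⟨_, ((tendsto_atTop_ciInf hanti hbdd).add hs.hasSum.tendsto_sum_nat).congr
    fun n => by ring⟩

theorem exists_pos_mul_norm_sq_le {E : Type*} [NormedAddCommGroup E] [NormedSpace ℝ E]
    [FiniteDimensional ℝ E] {Q : E → ℝ} (hQ : Continuous Q)
    (hsmul : ∀ (t : ℝ) v, Q (t • v) = t ^ 2 * Q v) (hpos : ∀ v, v ≠ 0 → 0 < Q v) :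
    ∃ c, 0 < c ∧ ∀ v, c * ‖v‖ ^ 2 ≤ Q v := by
  have h0 : Q 0 = 0 := by simpa using hsmul 0 0
  rcases (Metric.sphere (0 : E) 1).eq_empty_or_nonempty with hne | hne
  · refine ⟨1, one_pos, fun v => ?_⟩
    by_cases hv : v = 0
    · simp [hv, h0]
    · exfalso
      have : ‖v‖⁻¹ • v ∈ Metric.sphere (0 : E) 1 := by simp [norm_smul, hv]
      rw [hne] at this
      exact this
  · have := FiniteDimensional.proper ℝ E
    obtain ⟨w, hw, hmin⟩ := (isCompact_sphere (0 : E) 1).exists_isMinOn hne hQ.continuousOn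
    have hw0 : w ≠ 0 := by
      rintro rfl
      simp at hw
    refine ⟨Q w, hpos w hw0, fun v => ?_⟩
    by_cases hv : v = 0
    · simp [hv, h0]
    · have h1 : Q w ≤ Q (‖v‖⁻¹ • v) := hmin (by simp [norm_smul, hv])
      rw [hsmul, inv_pow] at h1
      have h2 : 0 < ‖v‖ ^ 2 := by positivity
      rw [inv_mul_eq_div, le_div_iff₀ h2] at h1
      exact h1

theorem tendsto_zero_of_mul_norm_sq_le {E : Type*} [NormedAddCommGroup E] {c : ℝ} (hc : 0 < c)
    {v : ℕ → E} {b : ℕ → ℝ} (hb : Tendsto b atTop (𝓝 0)) (h : ∀ k, c * ‖v k‖ ^ 2 ≤ b k) :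
    Tendsto v atTop (𝓝 0) := by
  rw [tendsto_zero_iff_norm_tendsto_zero]
  have h1 : Tendsto (fun k => √(b k / c)) atTop (𝓝 0) := by
    simpa using (hb.div_const c).sqrt
  refine squeeze_zero (fun k => norm_nonneg _) (fun k => ?_) h1
  apply Real.le_sqrt_of_sq_le
  rw [le_div_iff₀ hc]
  linarith [h k]

end Sequences

/-! ### The inexact proximal augmented Lagrangian method. -/

section ProxALM

variable {E X : Type*} [NormedAddCommGroup E] [InnerProductSpace ℝ E] [FiniteDimensional ℝ E]
  [NormedAddCommGroup X] [InnerProductSpace ℝ X] [FiniteDimensional ℝ X]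

/-- The solutions of `0 ∈ T y + B y + A* u`, `A y = a`. -/
def IsSaddle (T : E → Set E) (B : E → E) (A : E →ₗ[ℝ] X) (a : X) (y : E) (u : X) : Prop :=
  -B y - LinearMap.adjoint A u ∈ T y ∧ A y = a

/-- Iterates of an inexact proximal augmented Lagrangian method for the inclusion
`0 ∈ T y + B y + A* u`, `A y = a`, in which `B` is evaluated at the previous iterate. -/
structure IsInexactProxALM (T : E → Set E) (B : E → E) (A : E →ₗ[ℝ] X) (a : X)
    (S W : E →ₗ[ℝ] E) (σ τ μ : ℝ) (d y : ℕ → E) (u : ℕ → X) : Prop where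
  σ_pos : 0 < σ
  τ_pos : 0 < τ
  τ_lt : τ < 2
  μ_nonneg : 0 ≤ μ
  mono : ∀ {v g v' g'}, g ∈ T v → g' ∈ T v' → μ * ‖v - v'‖ ^ 2 ≤ ⟪g - g', v - v'⟫
  closed : ∀ {v g : ℕ → E} {v' g' : E}, Tendsto v atTop (𝓝 v') → Tendsto g atTop (𝓝 g') →
    (∀ n, g n ∈ T (v n)) → g' ∈ T v'
  cont : Continuous B
  coco : ∀ u v w, -(1 / 4) * ⟪w - u, S (w - u)⟫ ≤ ⟪B u - B v, w - v⟫
  S_nonneg : ∀ v, 0 ≤ ⟪v, S v⟫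
  W_symm : W.IsSymmetric
  V_nonneg : ∀ v, 0 ≤ ⟪v, W v⟫ - 1 / 2 * ⟪v, S v⟫
  V_pos : ∀ v, v ≠ 0 → 0 < ⟪v, W v⟫ - 1 / 2 * ⟪v, S v⟫ + σ * ‖A v‖ ^ 2 + μ * ‖v‖ ^ 2
  step : ∀ k, d k - B (y k) - LinearMap.adjoint A (u k + σ • (A (y (k + 1)) - a))
    - W (y (k + 1) - y k) ∈ T (y (k + 1))
  u_succ : ∀ k, u (k + 1) = u k + (τ * σ) • (A (y (k + 1)) - a)
  summable : Summable fun k => ‖d k‖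

namespace IsInexactProxALM

variable {T : E → Set E} {B : E → E} {A : E →ₗ[ℝ] X} {a : X} {S W : E →ₗ[ℝ] E} {σ τ μ : ℝ}
  {d y : ℕ → E} {u : ℕ → X}

/-- Monotonicity between the new iterate and the saddle point is doubled and combined with
three-point identities for `W` and for the multiplier. The multiplier update costs `τ σ ‖q‖²` while
the penalty gains `2 σ ‖q‖²`, which leaves `(2 - τ) σ ‖q‖²`. The gradient at the old iterate costs
half the `S`-form of the step. -/
theorem fejer (h : IsInexactProxALM T B A a S W σ τ μ d y u) {y' : E} {u' : X}
    (hs : IsSaddle T B A a y' u') (k : ℕ) :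
    1 / (τ * σ) * ‖u (k + 1) - u'‖ ^ 2 + ⟪y (k + 1) - y', W (y (k + 1) - y')⟫
      + (2 - τ) * σ * ‖A (y (k + 1)) - a‖ ^ 2 + 2 * μ * ‖y (k + 1) - y'‖ ^ 2
      + (⟪y (k + 1) - y k, W (y (k + 1) - y k)⟫
        - 1 / 2 * ⟪y (k + 1) - y k, S (y (k + 1) - y k)⟫)
    ≤ 1 / (τ * σ) * ‖u k - u'‖ ^ 2 + ⟪y k - y', W (y k - y')⟫
      + 2 * ⟪d k, y (k + 1) - y'⟫ := by
  have hσ := h.σ_pos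
  have hτ := h.τ_pos
  have h1 := h.mono (h.step k) hs.1
  have h2 := h.coco (y k) y' (y (k + 1))
  set q := A (y (k + 1)) - a with hq
  set Δ := y (k + 1) - y k with hΔ
  set e := y (k + 1) - y' with he
  have hAe : A e = q := by rw [he, map_sub, hs.2]
  have h3 : ⟪d k - B (y k) - LinearMap.adjoint A (u k + σ • q) - W Δ
      - (-B y' - LinearMap.adjoint A u'), e⟫
      = ⟪d k, e⟫ - ⟪B (y k) - B y', e⟫ - ⟪u k - u', q⟫ - σ * ‖q‖ ^ 2 - ⟪W Δ, e⟫ := by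
    have : d k - B (y k) - LinearMap.adjoint A (u k + σ • q) - W Δ
      - (-B y' - LinearMap.adjoint A u')
      = d k - (B (y k) - B y') - LinearMap.adjoint A ((u k - u') + σ • q) - W Δ := by
      simp only [map_add, map_sub]
      abel
    rw [this, inner_sub_left, inner_sub_left, inner_sub_left, LinearMap.adjoint_inner_left, hAe,
      inner_add_left, real_inner_smul_left, real_inner_self_eq_norm_sq]
    ring
  rw [h3] at h1
  have h4 : 1 / (τ * σ) * ‖u (k + 1) - u'‖ ^ 2
      = 1 / (τ * σ) * ‖u k - u'‖ ^ 2 + 2 * ⟪u k - u', q⟫ + τ * σ * ‖q‖ ^ 2 := by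
    have : u (k + 1) - u' = (u k - u') + (τ * σ) • q := by
      rw [h.u_succ k]
      abel
    rw [this, norm_add_sq_real, real_inner_smul_right, norm_smul, mul_pow, Real.norm_eq_abs,
      sq_abs]
    field_simp
  have h5 : ⟪y k - y', W (y k - y')⟫ = ⟪e, W e⟫ - 2 * ⟪W Δ, e⟫ + ⟪Δ, W Δ⟫ := by
    have h6 : y k - y' = e - Δ := by
      rw [he, hΔ]
      abel
    have h7 : ⟪Δ, W e⟫ = ⟪W Δ, e⟫ := (h.W_symm Δ e).symm
    have h8 : ⟪e, W Δ⟫ = ⟪W Δ, e⟫ := real_inner_comm _ _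
    rw [h6, map_sub, inner_sub_left, inner_sub_right, inner_sub_right, h7, h8]
    ring
  rw [h4, h5]
  linarith

/-- The Lyapunov function of the method at the saddle point `(y', u')`. -/
def lyapunov (A : E →ₗ[ℝ] X) (a : X) (W : E →ₗ[ℝ] E) (σ τ μ : ℝ) (y' : E) (u' : X)
    (y : E) (u : X) : ℝ :=
  1 / (τ * σ) * ‖u - u'‖ ^ 2 + ⟪y - y', W (y - y')⟫ + (2 - τ) * σ * ‖A y - a‖ ^ 2
    + 2 * μ * ‖y - y'‖ ^ 2

theorem W_nonneg (h : IsInexactProxALM T B A a S W σ τ μ d y u) (v : E) : 0 ≤ ⟪v, W v⟫ := by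
  linarith [h.V_nonneg v, h.S_nonneg v]

theorem norm_u_sq_le_lyapunov (h : IsInexactProxALM T B A a S W σ τ μ d y u) {y' : E} {u' : X}
    (v : E) (w : X) : 1 / (τ * σ) * ‖w - u'‖ ^ 2 ≤ lyapunov A a W σ τ μ y' u' v w := by
  have h1 := h.W_nonneg (v - y')
  have h2 : 0 ≤ (2 - τ) * σ * ‖A v - a‖ ^ 2 :=
    mul_nonneg (mul_nonneg (sub_nonneg.2 h.τ_lt.le) h.σ_pos.le) (sq_nonneg _)
  have h3 : 0 ≤ 2 * μ * ‖v - y'‖ ^ 2 :=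
    mul_nonneg (mul_nonneg zero_le_two h.μ_nonneg) (sq_nonneg _)
  unfold lyapunov
  linarith

theorem lyapunov_nonneg (h : IsInexactProxALM T B A a S W σ τ μ d y u) {y' : E} {u' : X}
    (v : E) (w : X) : 0 ≤ lyapunov A a W σ τ μ y' u' v w := by
  have h1 := h.norm_u_sq_le_lyapunov (y' := y') (u' := u') v w
  have h2 : 0 ≤ 1 / (τ * σ) * ‖w - u'‖ ^ 2 :=
    mul_nonneg (one_div_nonneg.2 (mul_pos h.τ_pos h.σ_pos).le) (sq_nonneg _)
  exact h2.trans h1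

/-- `W` alone may be degenerate. The feasibility and strong convexity terms belong to the Lyapunov
function because together with `W` they form a definite quadratic form, by `V_pos` and `τ < 2`. -/
theorem exists_le_lyapunov (h : IsInexactProxALM T B A a S W σ τ μ d y u) :
    ∃ c, 0 < c ∧ ∀ (y' : E) (u' : X), A y' = a → ∀ (v : E) (w : X),
      c * ‖v - y'‖ ^ 2 ≤ lyapunov A a W σ τ μ y' u' v w := by
  have hτ2 : 0 < 2 - τ := sub_pos.2 h.τ_lt
  obtain ⟨c, hc, hle⟩ := exists_pos_mul_norm_sq_le
    (Q := fun v => ⟪v, W v⟫ + (2 - τ) * σ * ‖A v‖ ^ 2 + 2 * μ * ‖v‖ ^ 2)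
    (by
      have h1 : Continuous W := W.continuous_of_finiteDimensional
      have h2 : Continuous A := A.continuous_of_finiteDimensional
      fun_prop)
    (by
      intro t v
      simp only [map_smul, norm_smul, mul_pow, Real.norm_eq_abs, sq_abs, real_inner_smul_left,
        real_inner_smul_right]
      ring)
    (by
      intro v hv
      have h1 := h.V_pos v hv
      have h2 := h.V_nonneg v
      have h3 := h.S_nonneg v
      have h4 : 0 ≤ σ * ‖A v‖ ^ 2 := mul_nonneg h.σ_pos.le (sq_nonneg _)
      have h5 : 0 ≤ μ * ‖v‖ ^ 2 := mul_nonneg h.μ_nonneg (sq_nonneg _)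
      by_contra! hle
      have h6 : 0 ≤ (2 - τ) * (σ * ‖A v‖ ^ 2) := mul_nonneg hτ2.le h4
      have h7 : (2 - τ) * (σ * ‖A v‖ ^ 2) = 0 := by nlinarith
      rcases mul_eq_zero.1 h7 with h8 | h8 <;> nlinarith)
  refine ⟨c, hc, fun y' u' hy' v w => ?_⟩
  have h1 := hle (v - y')
  have h2 : 0 ≤ 1 / (τ * σ) * ‖w - u'‖ ^ 2 :=
    mul_nonneg (one_div_nonneg.2 (mul_pos h.τ_pos h.σ_pos).le) (sq_nonneg _)
  rw [map_sub A, hy'] at h1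
  unfold lyapunov
  linarith

/-- The feasibility and strong convexity terms at the old iterate are added to both sides of
`fejer`, so that they reappear as part of the decrease. -/
theorem lyapunov_step (h : IsInexactProxALM T B A a S W σ τ μ d y u) {y' : E} {u' : X}
    (hs : IsSaddle T B A a y' u') (k : ℕ) :
    lyapunov A a W σ τ μ y' u' (y (k + 1)) (u (k + 1))
      + ((⟪y (k + 1) - y k, W (y (k + 1) - y k)⟫
          - 1 / 2 * ⟪y (k + 1) - y k, S (y (k + 1) - y k)⟫)
        + (2 - τ) * σ * ‖A (y k) - a‖ ^ 2 + 2 * μ * ‖y k - y'‖ ^ 2)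
    ≤ lyapunov A a W σ τ μ y' u' (y k) (u k) + 2 * (‖d k‖ * ‖y (k + 1) - y'‖) := by
  have h1 := h.fejer hs k
  have h2 := real_inner_le_norm (d k) (y (k + 1) - y')
  unfold lyapunov
  linarith

theorem exists_norm_le (h : IsInexactProxALM T B A a S W σ τ μ d y u) {y' : E} {u' : X}
    (hs : IsSaddle T B A a y' u') :
    ∃ M, ∀ k, ‖y k - y'‖ ≤ M ∧ ‖u k - u'‖ ≤ M := by
  obtain ⟨c, hc, hle⟩ := h.exists_le_lyapunov
  have hτσ : 0 < τ * σ := mul_pos h.τ_pos h.σ_pos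
  set L : ℕ → ℝ := fun k => lyapunov A a W σ τ μ y' u' (y k) (u k) with hL
  have hL0 : ∀ k, 0 ≤ L k := fun k => h.lyapunov_nonneg _ _
  have hy : ∀ k, ‖y k - y'‖ ≤ √(1 / c) * √(L k) := by
    intro k
    rw [← Real.sqrt_mul (by positivity)]
    apply Real.le_sqrt_of_sq_le
    have := hle y' u' hs.2 (y k) (u k)
    rw [one_div, inv_mul_eq_div, le_div_iff₀ hc]
    linarith
  have hu : ∀ k, ‖u k - u'‖ ≤ √(τ * σ) * √(L k) := by
    intro k
    rw [← Real.sqrt_mul hτσ.le]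
    apply Real.le_sqrt_of_sq_le
    have := h.norm_u_sq_le_lyapunov (y' := y') (u' := u') (y k) (u k)
    rw [one_div, inv_mul_eq_div, div_le_iff₀ hτσ] at this
    linarith
  -- The error `2 ‖d k‖ ‖y (k + 1) - y'‖` is at most `2 √(1 / c) ‖d k‖` times the square root of the
  -- new Lyapunov value.
  obtain ⟨M, hM⟩ := exists_bound_of_le_add_mul_sqrt (L := L)
    (e := fun k => 2 * √(1 / c) * ‖d k‖) hL0 (fun k => by positivity)
    (h.summable.mul_left _) (by
      intro k
      have h1 := h.lyapunov_step hs k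
      have h2 := h.V_nonneg (y (k + 1) - y k)
      have h3 : 0 ≤ (2 - τ) * σ * ‖A (y k) - a‖ ^ 2 :=
        mul_nonneg (mul_nonneg (sub_nonneg.2 h.τ_lt.le) h.σ_pos.le) (sq_nonneg _)
      have h4 : 0 ≤ 2 * μ * ‖y k - y'‖ ^ 2 :=
        mul_nonneg (mul_nonneg zero_le_two h.μ_nonneg) (sq_nonneg _)
      have h5 := mul_le_mul_of_nonneg_left (hy (k + 1)) (norm_nonneg (d k))
      change L (k + 1) + _ ≤ L k + _ at h1
      linarith)
  refine ⟨max (√(1 / c) * M) (√(τ * σ) * M), fun k => ⟨?_, ?_⟩⟩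
  · exact (hy k).trans ((mul_le_mul_of_nonneg_left (hM k) (Real.sqrt_nonneg _)).trans
      (le_max_left _ _))
  · exact (hu k).trans ((mul_le_mul_of_nonneg_left (hM k) (Real.sqrt_nonneg _)).trans
      (le_max_right _ _))

/-- Once the iterates are bounded by `M`, the error is at most `2 M ‖d k‖`, hence summable, and the
decrements are summable as well. -/
theorem asymptotics (h : IsInexactProxALM T B A a S W σ τ μ d y u) {y' : E} {u' : X}
    (hs : IsSaddle T B A a y' u') :
    (∃ l, Tendsto (fun k => lyapunov A a W σ τ μ y' u' (y k) (u k)) atTop (𝓝 l)) ∧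
    Tendsto (fun k => ⟪y (k + 1) - y k, W (y (k + 1) - y k)⟫
      - 1 / 2 * ⟪y (k + 1) - y k, S (y (k + 1) - y k)⟫) atTop (𝓝 0) ∧
    Tendsto (fun k => A (y k) - a) atTop (𝓝 0) ∧
    Tendsto (fun k => μ * ‖y k - y'‖ ^ 2) atTop (𝓝 0) := by
  obtain ⟨M, hM⟩ := h.exists_norm_le hs
  have hM0 : 0 ≤ M := (norm_nonneg _).trans (hM 0).1
  have hV := fun k => h.V_nonneg (y (k + 1) - y k)
  have hτσ : 0 < (2 - τ) * σ := mul_pos (sub_pos.2 h.τ_lt) h.σ_pos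
  have hq : ∀ k, 0 ≤ (2 - τ) * σ * ‖A (y k) - a‖ ^ 2 :=
    fun k => mul_nonneg hτσ.le (sq_nonneg _)
  have hμ : ∀ k, 0 ≤ 2 * μ * ‖y k - y'‖ ^ 2 :=
    fun k => mul_nonneg (mul_nonneg zero_le_two h.μ_nonneg) (sq_nonneg _)
  obtain ⟨h1, h2⟩ := summable_and_tendsto_of_add_le_add
    (L := fun k => lyapunov A a W σ τ μ y' u' (y k) (u k))
    (s := fun k => 2 * M * ‖d k‖) (fun k => h.lyapunov_nonneg _ _)
    (fun k => add_nonneg (add_nonneg (hV k) (hq k)) (hμ k)) (fun k => by positivity)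
    (h.summable.mul_left _) (by
      intro k
      have := h.lyapunov_step hs k
      have h5 := mul_le_mul_of_nonneg_left (hM (k + 1)).1 (norm_nonneg (d k))
      linarith)
  have h3 := h1.tendsto_atTop_zero
  refine ⟨h2, squeeze_zero hV (fun k => ?_) h3,
    tendsto_zero_of_mul_norm_sq_le hτσ h3 (fun k => ?_),
    squeeze_zero (fun k => mul_nonneg h.μ_nonneg (sq_nonneg _)) (fun k => ?_) h3⟩
  · linarith [hq k, hμ k]
  · linarith [hV k, hμ k]
  · linarith [hV k, hq k, hμ k]

/-- Only the sum of the forms in `V_pos` is definite, so each of them is shown to vanish on the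
step: `A` of the step is a difference of two residuals, and `μ` times its squared norm is bounded
through the distances to `y'`. -/
theorem tendsto_sub (h : IsInexactProxALM T B A a S W σ τ μ d y u) {y' : E} {u' : X}
    (hs : IsSaddle T B A a y' u') : Tendsto (fun k => y (k + 1) - y k) atTop (𝓝 0) := by
  obtain ⟨-, hV, hq, hμ⟩ := h.asymptotics hs
  obtain ⟨c, hc, hle⟩ := exists_pos_mul_norm_sq_le
    (Q := fun v => ⟪v, W v⟫ - 1 / 2 * ⟪v, S v⟫ + σ * ‖A v‖ ^ 2 + μ * ‖v‖ ^ 2)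
    (by
      have h1 : Continuous W := W.continuous_of_finiteDimensional
      have h2 : Continuous A := A.continuous_of_finiteDimensional
      have h3 : Continuous S := S.continuous_of_finiteDimensional
      fun_prop)
    (by
      intro t v
      simp only [map_smul, norm_smul, mul_pow, Real.norm_eq_abs, sq_abs, real_inner_smul_left,
        real_inner_smul_right]
      ring)
    h.V_pos
  have hq' := ((tendsto_add_atTop_iff_nat 1).2 hq).sub hq
  have hμ' := (((tendsto_add_atTop_iff_nat 1).2 hμ).add hμ).const_mul 2
  have h1 := (hV.add ((hq'.norm.pow 2).const_mul σ)).add hμ'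
  simp only [sub_zero, norm_zero, ne_eq, OfNat.ofNat_ne_zero, not_false_eq_true, zero_pow,
    mul_zero, add_zero] at h1
  refine tendsto_zero_of_mul_norm_sq_le hc h1 (fun k => (hle _).trans ?_)
  have h2 : A (y (k + 1) - y k) = A (y (k + 1)) - a - (A (y k) - a) := by
    rw [map_sub]
    abel
  have h3 : ‖y (k + 1) - y k‖ ^ 2 ≤ 2 * (‖y (k + 1) - y'‖ ^ 2 + ‖y k - y'‖ ^ 2) := by
    have h4 : ‖y (k + 1) - y k‖ ≤ ‖y (k + 1) - y'‖ + ‖y k - y'‖ := by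
      have : y (k + 1) - y k = (y (k + 1) - y') - (y k - y') := by abel
      rw [this]
      exact norm_sub_le _ _
    have h5 := pow_le_pow_left₀ (norm_nonneg _) h4 2
    nlinarith [sq_nonneg (‖y (k + 1) - y'‖ - ‖y k - y'‖)]
  have h4 := mul_le_mul_of_nonneg_left h3 h.μ_nonneg
  rw [h2]
  linarith

/-- An Opial-type argument: boundedness gives a cluster point, and the closed graph of `T` makes it
a saddle point, so the Lyapunov function may be centred there. -/
theorem tendsto_saddle (h : IsInexactProxALM T B A a S W σ τ μ d y u)
    (hne : ∃ y' u', IsSaddle T B A a y' u') :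
    ∃ y' u', IsSaddle T B A a y' u' ∧ Tendsto y atTop (𝓝 y') ∧ Tendsto u atTop (𝓝 u') := by
  obtain ⟨y₀, u₀, hs₀⟩ := hne
  obtain ⟨M, hM⟩ := h.exists_norm_le hs₀
  have hΔ := h.tendsto_sub hs₀
  obtain ⟨-, -, hq, -⟩ := h.asymptotics hs₀
  have := FiniteDimensional.proper ℝ E
  have := FiniteDimensional.proper ℝ X
  have hWc : Continuous W := W.continuous_of_finiteDimensional
  have hAc : Continuous A := A.continuous_of_finiteDimensional
  have hAc' : Continuous (LinearMap.adjoint A) :=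
    (LinearMap.adjoint A).continuous_of_finiteDimensional
  obtain ⟨⟨y', u'⟩, -, ψ, hψ, hlim⟩ := tendsto_subseq_of_bounded
    (s := Metric.closedBall (y₀, u₀) M) Metric.isBounded_closedBall (x := fun k => (y k, u k))
    (fun k => by
      rw [Metric.mem_closedBall, Prod.dist_eq, dist_eq_norm, dist_eq_norm]
      exact max_le (hM k).1 (hM k).2)
  have hψ' := hψ.tendsto_atTop
  have hy : Tendsto (fun n => y (ψ n)) atTop (𝓝 y') := (continuous_fst.tendsto _).comp hlim
  have hu : Tendsto (fun n => u (ψ n)) atTop (𝓝 u') := (continuous_snd.tendsto _).comp hlim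
  have hΔψ : Tendsto (fun n => y (ψ n + 1) - y (ψ n)) atTop (𝓝 0) := hΔ.comp hψ'
  have hy1 : Tendsto (fun n => y (ψ n + 1)) atTop (𝓝 y') := by
    simpa using hy.add hΔψ
  have hqψ : Tendsto (fun n => A (y (ψ n)) - a) atTop (𝓝 0) := hq.comp hψ'
  have hq1 : Tendsto (fun n => A (y (ψ n + 1)) - a) atTop (𝓝 0) :=
    ((tendsto_add_atTop_iff_nat 1).2 hq).comp hψ'
  have hA : A y' = a := by
    have h1 : Tendsto (fun n => A (y (ψ n)) - a) atTop (𝓝 (A y' - a)) :=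
      ((hAc.tendsto _).comp hy).sub_const a
    exact sub_eq_zero.1 (tendsto_nhds_unique h1 hqψ)
  have hd : Tendsto (fun n => d (ψ n)) atTop (𝓝 0) :=
    (tendsto_zero_iff_norm_tendsto_zero.2 h.summable.tendsto_atTop_zero).comp hψ'
  have hg : -B y' - LinearMap.adjoint A u' ∈ T y' := by
    refine h.closed hy1 ?_ (fun n => h.step (ψ n))
    have h1 := ((hd.sub ((h.cont.tendsto _).comp hy)).sub
      ((hAc'.tendsto _).comp (hu.add (hq1.const_smul σ)))).sub ((hWc.tendsto _).comp hΔψ)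
    simpa using h1
  have hs : IsSaddle T B A a y' u' := ⟨hg, hA⟩
  obtain ⟨⟨l, hl⟩, -, -, hμ⟩ := h.asymptotics hs
  have hl0 : Tendsto (fun n => lyapunov A a W σ τ μ y' u' (y (ψ n)) (u (ψ n))) atTop (𝓝 0) := by
    have h1 : Continuous (fun p : E × X => lyapunov A a W σ τ μ y' u' p.1 p.2) := by
      unfold lyapunov
      fun_prop
    have h2 := (h1.tendsto (y', u')).comp hlim
    have h3 : lyapunov A a W σ τ μ y' u' y' u' = 0 := by
      simp [lyapunov, hA]
    rw [h3] at h2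
    exact h2
  -- The centred Lyapunov function converges along the whole sequence and tends to zero along the
  -- subsequence.
  have hl' : l = 0 := tendsto_nhds_unique (hl.comp hψ') hl0
  rw [hl'] at hl
  obtain ⟨c, hc, hle⟩ := h.exists_le_lyapunov
  refine ⟨y', u', hs, ?_, ?_⟩
  · exact tendsto_sub_nhds_zero_iff.1
      (tendsto_zero_of_mul_norm_sq_le hc hl (fun k => hle y' u' hA (y k) (u k)))
  · exact tendsto_sub_nhds_zero_iff.1
      (tendsto_zero_of_mul_norm_sq_le (one_div_pos.2 (mul_pos h.τ_pos h.σ_pos)) hl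
        (fun k => h.norm_u_sq_le_lyapunov (y k) (u k)))

end IsInexactProxALM

end ProxALM

/-! ### Projections attached to the kernel and the range of an operator. -/

section LinearAlgebra

variable {X Z : Type*} [NormedAddCommGroup X] [InnerProductSpace ℝ X] [FiniteDimensional ℝ X]
  [NormedAddCommGroup Z] [InnerProductSpace ℝ Z] [FiniteDimensional ℝ Z]

theorem map_starProjection_ker (G : X →ₗ[ℝ] Z) (v : X) :
    G ((LinearMap.ker G).starProjection v) = 0 :=
  LinearMap.mem_ker.1 (Submodule.starProjection_apply_mem _ _)

/-- `G` is injective on the orthogonal complement of its kernel, so `‖G v‖² + ‖Q v‖²`, with `Q` the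
projection onto `ker G`, is a definite form; it is applied to `v - Q v`. -/
theorem exists_norm_sub_starProjection_ker_le (G : X →ₗ[ℝ] Z) :
    ∃ C, 0 ≤ C ∧ ∀ v, ‖v - (LinearMap.ker G).starProjection v‖ ≤ C * ‖G v‖ := by
  have hGc : Continuous G := G.continuous_of_finiteDimensional
  obtain ⟨c, hc, hle⟩ := exists_pos_mul_norm_sq_le
    (Q := fun v => ‖G v‖ ^ 2 + ‖(LinearMap.ker G).starProjection v‖ ^ 2) (by fun_prop)
    (by
      intro t v
      simp only [map_smul, norm_smul, mul_pow, Real.norm_eq_abs, sq_abs]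
      ring)
    (by
      intro v hv
      by_cases hG : G v = 0
      · have : (LinearMap.ker G).starProjection v = v :=
          Submodule.starProjection_eq_self_iff.2 (LinearMap.mem_ker.2 hG)
        rw [this]
        positivity
      · positivity)
  refine ⟨√(1 / c), Real.sqrt_nonneg _, fun v => ?_⟩
  have h1 := hle (v - (LinearMap.ker G).starProjection v)
  have h2 : (LinearMap.ker G).starProjection (v - (LinearMap.ker G).starProjection v) = 0 := by
    rw [map_sub, Submodule.starProjection_eq_self_iff.2 (Submodule.starProjection_apply_mem _ v),
      sub_self]
  rw [h2, map_sub, map_starProjection_ker, sub_zero, norm_zero] at h1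
  rw [← Real.sqrt_sq (norm_nonneg (G v)), ← Real.sqrt_mul (by positivity)]
  apply Real.le_sqrt_of_sq_le
  rw [one_div, inv_mul_eq_div, le_div_iff₀ hc]
  linarith

theorem starProjection_ker_adjoint (G : X →ₗ[ℝ] Z) (z : Z) :
    (LinearMap.ker G).starProjection (LinearMap.adjoint G z) = 0 := by
  rw [Submodule.starProjection_apply_eq_zero_iff]
  intro v hv
  rw [LinearMap.adjoint_inner_right, LinearMap.mem_ker.1 hv, inner_zero_left]

theorem adjoint_starProjection_range (G : X →ₗ[ℝ] Z) (z : Z) :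
    LinearMap.adjoint G ((LinearMap.range G).starProjection z) = LinearMap.adjoint G z := by
  apply ext_inner_right ℝ
  intro v
  rw [LinearMap.adjoint_inner_left, LinearMap.adjoint_inner_left]
  have := Submodule.starProjection_inner_eq_zero z (G v) (LinearMap.mem_range_self G v)
  rw [inner_sub_left] at this
  linarith

theorem starProjection_range_eq (G : X →ₗ[ℝ] Z) (z : Z) :
    (LinearMap.range G).starProjection z
      = z - (LinearMap.ker (LinearMap.adjoint G)).starProjection z := by
  apply Submodule.eq_starProjection_of_mem_of_inner_eq_zero
  · rw [← Submodule.orthogonal_orthogonal (LinearMap.range G), LinearMap.orthogonal_range]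
    exact Submodule.sub_starProjection_mem_orthogonal z
  · rintro _ ⟨v, rfl⟩
    rw [sub_sub_cancel, ← LinearMap.adjoint_inner_left, map_starProjection_ker, inner_zero_left]

/-- The projection onto `Range G` removes exactly the component in `ker G*`, and off that kernel
`G*` controls the norm. -/
theorem tendsto_starProjection_range {G : X →ₗ[ℝ] Z} {z : ℕ → Z} {z' : Z}
    (h : Tendsto (fun k => LinearMap.adjoint G (z k)) atTop (𝓝 (LinearMap.adjoint G z'))) :
    Tendsto (fun k => (LinearMap.range G).starProjection (z k)) atTop
      (𝓝 ((LinearMap.range G).starProjection z')) := by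
  obtain ⟨C, hC, hle⟩ := exists_norm_sub_starProjection_ker_le (LinearMap.adjoint G)
  rw [tendsto_iff_norm_sub_tendsto_zero] at h ⊢
  have h1 := h.const_mul C
  rw [mul_zero] at h1
  refine squeeze_zero (fun _ => norm_nonneg _) (fun k => ?_) h1
  rw [← map_sub, ← map_sub, starProjection_range_eq]
  exact hle _

theorem exists_adjoint_eq_of_tendsto {G : X →ₗ[ℝ] Z} {z : ℕ → Z} {g : X}
    (h : Tendsto (fun k => LinearMap.adjoint G (z k)) atTop (𝓝 g)) :
    ∃ z', LinearMap.adjoint G z' = g :=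
  LinearMap.mem_range.1 <|
    (Submodule.closed_of_finiteDimensional (LinearMap.range (LinearMap.adjoint G))).mem_of_tendsto h
      (Eventually.of_forall fun _ => LinearMap.mem_range_self _ _)

end LinearAlgebra

/-! ### Inclusions of the factors into the product space. -/

section Blocks

variable {m : ℕ} {Y : Fin (m + 1) → Type*} [∀ i, NormedAddCommGroup (Y i)]
  [∀ i, InnerProductSpace ℝ (Y i)]

theorem incl_apply (i : Fin (m + 1)) (v : Y i) (j : Fin (m + 1)) :
    incl i v j = (Pi.single i v : ∀ j, Y j) j := rfl

@[simp] theorem incl_apply_same (i : Fin (m + 1)) (v : Y i) : incl i v i = v := by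
  rw [incl_apply, Pi.single_eq_same]

theorem incl_apply_ne {i j : Fin (m + 1)} (h : j ≠ i) (v : Y i) : incl i v j = 0 := by
  rw [incl_apply, Pi.single_eq_of_ne h]

theorem inner_incl_left (i : Fin (m + 1)) (v : Y i) (w : PiLp 2 Y) : ⟪incl i v, w⟫ = ⟪v, w i⟫ := by
  rw [PiLp.inner_apply, Finset.sum_eq_single i]
  · rw [incl_apply_same]
  · intro j _ hj
    rw [incl_apply_ne hj, inner_zero_left]
  · simp

theorem inner_incl_right (i : Fin (m + 1)) (v : Y i) (w : PiLp 2 Y) :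
    ⟪w, incl i v⟫ = ⟪w i, v⟫ := by
  rw [real_inner_comm, inner_incl_left, real_inner_comm]

end Blocks

/-! ### KKT points, optimality and objective values. -/

namespace Problem

variable {m : ℕ} {X : Type*} {Y : Fin (m + 1) → Type*} {Z : Type*}
  [NormedAddCommGroup X] [InnerProductSpace ℝ X] [FiniteDimensional ℝ X]
  [∀ i, NormedAddCommGroup (Y i)] [∀ i, InnerProductSpace ℝ (Y i)]
  [∀ i, FiniteDimensional ℝ (Y i)]
  [NormedAddCommGroup Z] [InnerProductSpace ℝ Z] [FiniteDimensional ℝ Z]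

variable (P : Problem X Y Z)

/-- The subdifferential `(∂p (y_1); 0)` of `y ↦ p (y_1)`. -/
def blockSubdiff (v : PiLp 2 Y) : Set (PiLp 2 Y) :=
  {g | g 0 ∈ subdiff P.p (v 0) ∧ ∀ i, i ≠ 0 → g i = 0}

theorem inner_blockSubdiff {v g w : PiLp 2 Y} (hg : g ∈ P.blockSubdiff v) :
    ⟪g, w⟫ = ⟪g 0, w 0⟫ := by
  rw [PiLp.inner_apply, Finset.sum_eq_single 0]
  · intro j _ hj
    rw [hg.2 j hj, inner_zero_left]
  · simp

theorem neg_sub_mem_blockSubdiff_iff {y h l : PiLp 2 Y} :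
    -h - l ∈ P.blockSubdiff y ↔ ∃ g ∈ subdiff P.p (y 0), incl 0 g + h + l = 0 := by
  constructor
  · intro hg
    refine ⟨_, hg.1, ?_⟩
    have : incl 0 ((-h - l) 0) = -h - l := by
      ext i
      by_cases hi : i = 0
      · subst hi
        rw [incl_apply_same]
      · rw [incl_apply_ne hi, hg.2 i hi]
    rw [this]
    abel
  · rintro ⟨g, hg, h0⟩
    have : -h - l = incl 0 g := by
      rw [add_assoc] at h0
      rw [eq_neg_of_add_eq_zero_left h0]
      abel
    rw [this]
    refine ⟨?_, fun i hi => incl_apply_ne hi g⟩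
    rwa [incl_apply_same]

theorem isKKT_iff {x : X} {y : PiLp 2 Y} {z : Z} :
    P.IsKKT x y z ↔ -∇ P.f y - P.F x ∈ P.blockSubdiff y ∧ P.G x = P.b ∧ P.residual y z = 0 := by
  rw [IsKKT, neg_sub_mem_blockSubdiff_iff, sub_eq_zero, residual, sub_eq_zero]

/-- Strong convexity of `p` controls block `0` only; a positive modulus on the whole product
therefore needs a single block. -/
theorem blockSubdiff_mono {μ : ℝ} (hμ : 0 ≤ μ)
    (hp : ∀ {v g v' g'}, g ∈ subdiff P.p v → g' ∈ subdiff P.p v' →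
      μ * ‖v - v'‖ ^ 2 ≤ ⟪g - g', v - v'⟫)
    (hm : μ = 0 ∨ m = 0) {v g v' g' : PiLp 2 Y} (hg : g ∈ P.blockSubdiff v)
    (hg' : g' ∈ P.blockSubdiff v') : μ * ‖v - v'‖ ^ 2 ≤ ⟪g - g', v - v'⟫ := by
  have h1 := hp hg.1 hg'.1
  rw [inner_sub_left, P.inner_blockSubdiff hg, P.inner_blockSubdiff hg', ← inner_sub_left]
  rcases hm with rfl | rfl
  · simpa using h1
  · have : ‖v - v'‖ ^ 2 = ‖v 0 - v' 0‖ ^ 2 := by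
      rw [PiLp.norm_sq_eq_of_L2]
      simp
    rw [this]
    exact h1

theorem mem_blockSubdiff_of_tendsto {v g : ℕ → PiLp 2 Y} {v' g' : PiLp 2 Y}
    (hv : Tendsto v atTop (𝓝 v')) (hg : Tendsto g atTop (𝓝 g'))
    (h : ∀ n, g n ∈ P.blockSubdiff (v n)) : g' ∈ P.blockSubdiff v' := by
  have hc : ∀ i, Continuous (fun w : PiLp 2 Y => w i) := fun i => by fun_prop
  refine ⟨mem_subdiff_of_tendsto P.p_closedProperConvex.ne_bot P.p_closedProperConvex.closed
    (((hc 0).tendsto _).comp hv) (((hc 0).tendsto _).comp hg)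
    (Eventually.of_forall fun n => (h n).1), fun i hi => ?_⟩
  refine tendsto_nhds_unique (((hc i).tendsto _).comp hg) ?_
  have : (fun w : PiLp 2 Y => w i) ∘ g = fun _ => 0 := by
    ext n
    exact (h n).2 i hi
  rw [this]
  exact tendsto_const_nhds

theorem differentiable_f : Differentiable ℝ P.f := P.f_contDiff.differentiable one_ne_zero

theorem continuous_gradient : Continuous (∇ P.f) := by
  obtain ⟨K, hK⟩ := P.f_lipschitz
  exact hK.continuous

theorem inner_residual (x : X) (y : PiLp 2 Y) (z : Z) :
    ⟪x, P.residual y z⟫ = ⟪P.F x, y⟫ + ⟪P.G x, z⟫ - ⟪x, P.c⟫ := by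
  rw [residual, inner_sub_right, inner_add_right, LinearMap.adjoint_inner_right,
    LinearMap.adjoint_inner_right]

/-- The subgradient inequality for `p` and the gradient inequality for `f` add up, and `G x = b`
removes the dependence on `z`. Primal and dual optimality both follow from this. -/
theorem lagrangian_le_of_isKKT {x : X} {y : PiLp 2 Y} {z : Z} (h : P.IsKKT x y z)
    (y' : PiLp 2 Y) (z' : Z) : P.lagrangian y z x ≤ P.lagrangian y' z' x := by
  rw [isKKT_iff] at h
  obtain ⟨hg, hG, -⟩ := h
  have hb := P.p_closedProperConvex.ne_bot
  have hy := mem_effDomain_of_mem_subdiff P.p_closedProperConvex.proper hg.1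
  unfold lagrangian
  by_cases hy' : P.p (y' 0) = ⊤
  · rw [hy', EReal.top_add_coe]
    exact le_top
  have h1 := (mem_subdiff_iff hb hy).1 hg.1 (y' 0) hy'
  rw [← coe_toReal_of_mem_effDomain hb hy, ← coe_toReal_of_mem_effDomain hb hy', ← EReal.coe_add,
    ← EReal.coe_add, EReal.coe_le_coe_iff, inner_residual, inner_residual, hG]
  have h2 := ConvexOn.add_inner_gradient_le P.f_convex P.differentiable_f y y'
  have h3 : ⟪(-∇ P.f y - P.F x) 0, y' 0 - y 0⟫ = ⟪-∇ P.f y - P.F x, y' - y⟫ :=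
    (P.inner_blockSubdiff hg (w := y' - y)).symm
  rw [h3, inner_sub_left, inner_neg_left, inner_sub_right (P.F x)] at h1
  linarith

theorem lagrangian_eq_objective {y : PiLp 2 Y} {z : Z} (h : P.residual y z = 0) (x : X) :
    P.lagrangian y z x = P.objective y z := by
  rw [lagrangian, objective, h, inner_zero_right, add_zero]

theorem IsKKT.isSolution {P : Problem X Y Z} {x : X} {y : PiLp 2 Y} {z : Z}
    (h : P.IsKKT x y z) : P.IsSolution y z := by
  have hr := (P.isKKT_iff.1 h).2.2
  refine ⟨hr, fun y' z' hr' => ?_⟩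
  rw [← P.lagrangian_eq_objective hr x, ← P.lagrangian_eq_objective hr' x]
  exact P.lagrangian_le_of_isKKT h y' z'

theorem IsKKT.isDualSolution {P : Problem X Y Z} {x : X} {y : PiLp 2 Y} {z : Z}
    (h : P.IsKKT x y z) : P.IsDualSolution x := by
  have hr := (P.isKKT_iff.1 h).2.2
  intro x'
  calc P.dualFunction x' ≤ P.lagrangian y z x' := (iInf_le _ y).trans (iInf_le _ z)
    _ = P.lagrangian y z x := by
      rw [P.lagrangian_eq_objective hr, P.lagrangian_eq_objective hr]
    _ ≤ P.dualFunction x := le_iInf₂ fun y' z' => P.lagrangian_le_of_isKKT h y' z'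

theorem IsSolution.objective_eq {P : Problem X Y Z} {y : PiLp 2 Y} {z : Z}
    (h : P.IsSolution y z) : P.objective y z = P.optValue := by
  unfold optValue
  apply le_antisymm
  · exact le_iInf fun y' => le_iInf fun z' => le_iInf fun hr => h.2 y' z' hr
  · exact (iInf_le _ y).trans ((iInf_le _ z).trans (iInf_le _ h.1))

/-- The KKT system sees `z` only through `G* z`, so its component in `ker G*` may be changed freely.
-/
theorem IsKKT.congr_adjoint {P : Problem X Y Z} {x : X} {y : PiLp 2 Y} {z z' : Z}
    (h : P.IsKKT x y z) (hz : LinearMap.adjoint P.G z' = LinearMap.adjoint P.G z) :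
    P.IsKKT x y z' :=
  ⟨h.1, h.2.1, by rw [hz]; exact h.2.2⟩

/-- Semicontinuity bounds `p` from below in the limit; convergent subgradients at the iterates,
tested at `y'`, bound it from above. As `b = G x'`, one has `⟪b, z⟫ = ⟪x', G* z⟫`, so `z` itself
need not converge. -/
theorem tendsto_objective {x' : X} {y : ℕ → PiLp 2 Y} {y' : PiLp 2 Y} {z : ℕ → Z} {z' : Z}
    {g : ℕ → PiLp 2 Y} {g' : PiLp 2 Y} (hKKT : P.IsKKT x' y' z') (hy : Tendsto y atTop (𝓝 y'))
    (hz : Tendsto (fun k => LinearMap.adjoint P.G (z k)) atTop (𝓝 (LinearMap.adjoint P.G z')))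
    (hg : Tendsto g atTop (𝓝 g')) (h : ∀ k, g k ∈ P.blockSubdiff (y k)) :
    Tendsto (fun k => P.objective (y k) (z k)) atTop (𝓝 P.optValue) := by
  have hb := P.p_closedProperConvex.ne_bot
  have hc : Continuous (fun w : PiLp 2 Y => w 0) := by fun_prop
  have hy0 : Tendsto (fun k => y k 0) atTop (𝓝 (y' 0)) := (hc.tendsto _).comp hy
  have hg0 : Tendsto (fun k => g k 0) atTop (𝓝 (g' 0)) := (hc.tendsto _).comp hg
  have hKKT' := P.isKKT_iff.1 hKKT
  have hmem := mem_effDomain_of_mem_subdiff P.p_closedProperConvex.proper hKKT'.1.1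
  have hmemk := fun k => mem_effDomain_of_mem_subdiff P.p_closedProperConvex.proper (h k).1
  have hp : Tendsto (fun k => P.p (y k 0)) atTop (𝓝 (P.p (y' 0))) := by
    rw [tendsto_order]
    refine ⟨fun c hlt => hy0.eventually (P.p_closedProperConvex.closed (y' 0) c hlt),
      fun c hlt => ?_⟩
    have h1 : Tendsto (fun k => (((P.p (y' 0)).toReal - ⟪g k 0, y' 0 - y k 0⟫ : ℝ) : EReal)) atTop
        (𝓝 (((P.p (y' 0)).toReal - ⟪g' 0, y' 0 - y' 0⟫ : ℝ) : EReal)) :=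
      (continuous_coe_real_ereal.tendsto _).comp
        (tendsto_const_nhds.sub (hg0.inner (tendsto_const_nhds.sub hy0)))
    rw [sub_self, inner_zero_right, sub_zero, coe_toReal_of_mem_effDomain hb hmem] at h1
    filter_upwards [h1.eventually (gt_mem_nhds hlt)] with k hk
    refine lt_of_le_of_lt ?_ hk
    rw [← coe_toReal_of_mem_effDomain hb (hmemk k), EReal.coe_le_coe_iff]
    linarith [(mem_subdiff_iff hb (hmemk k)).1 (h k).1 (y' 0) hmem]
  have hr : Tendsto (fun k => ((P.f (y k) - ⟪P.b, z k⟫ : ℝ) : EReal)) atTop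
      (𝓝 ((P.f y' - ⟪P.b, z'⟫ : ℝ) : EReal)) := by
    have h1 : ∀ w, ⟪P.b, w⟫ = ⟪x', LinearMap.adjoint P.G w⟫ := by
      intro w
      rw [LinearMap.adjoint_inner_right, hKKT'.2.1]
    simp only [h1]
    exact (continuous_coe_real_ereal.tendsto _).comp
      (((P.differentiable_f.continuous.tendsto _).comp hy).sub (tendsto_const_nhds.inner hz))
  rw [← hKKT.isSolution.objective_eq]
  exact (EReal.continuousAt_add (Or.inr (EReal.coe_ne_bot _))
    (Or.inr (EReal.coe_ne_top _))).tendsto.comp (hp.prodMk_nhds hr)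

end Problem

/-! ### Elimination of `z` and convergence of the inexact proximal ADMM. -/

theorem summable_of_succ_le_mul_add {r e : ℕ → ℝ} {q : ℝ} (hq : q < 1) (hr : ∀ k, 0 ≤ r k)
    (he0 : ∀ k, 0 ≤ e k) (he : Summable e) (h : ∀ k, r (k + 1) ≤ q * r k + e k) : Summable r := by
  have h1 := (summable_and_tendsto_of_add_le_add (r := fun k => (1 - q) * r k) hr
    (fun k => mul_nonneg (sub_nonneg.2 hq.le) (hr k)) he0 he (fun k => by linarith [h k])).1
  exact (summable_mul_left_iff (sub_pos.2 hq).ne').1 h1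

theorem mapClusterPt_map_eq {α β : Type*} [TopologicalSpace α] [TopologicalSpace β] [T2Space β]
    {u : ℕ → α} {a : α} {f : α → β} {b : β} (hf : Continuous f) (hu : MapClusterPt a atTop u)
    (hb : Tendsto (fun k => f (u k)) atTop (𝓝 b)) : f a = b := by
  have h1 : MapClusterPt (f a) atTop (f ∘ u) := hu.continuousAt_comp hf.continuousAt
  have h2 : (𝓝 (f a) ⊓ 𝓝 b).NeBot := NeBot.mono (show (𝓝 (f a) ⊓ map (f ∘ u) atTop).NeBot from h1) 
    (inf_le_inf_left _ hb)
  exact eq_of_nhds_neBot h2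

namespace Problem

variable {m : ℕ} {X : Type*} {Y : Fin (m + 1) → Type*} {Z : Type*}
  [NormedAddCommGroup X] [InnerProductSpace ℝ X] [FiniteDimensional ℝ X]
  [∀ i, NormedAddCommGroup (Y i)] [∀ i, InnerProductSpace ℝ (Y i)]
  [∀ i, FiniteDimensional ℝ (Y i)]
  [NormedAddCommGroup Z] [InnerProductSpace ℝ Z] [FiniteDimensional ℝ Z]

/-- An inexact linearized ADMM in which all blocks of `y` are updated at once, with the proximal
operator `N`, errors `δ k` in the `y`-step and tolerances `ε k` in the `z`-step. -/
structure IsInexactProxADMM (P : Problem X Y Z) (N : PiLp 2 Y →ₗ[ℝ] PiLp 2 Y) (σ τ : ℝ)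
    (ε : ℕ → ℝ) (δ : ℕ → PiLp 2 Y) (x : ℕ → X) (y : ℕ → PiLp 2 Y) (z : ℕ → Z) : Prop where
  tol_nonneg : ∀ k, 0 ≤ ε k
  tol_summable : Summable ε
  err_summable : Summable fun k => ‖δ k‖
  step_y : ∀ k, δ k - ∇ P.f (y k) - P.F (x k) - σ • P.F (P.residual (y (k + 1)) (z k))
    - N (y (k + 1) - y k) ∈ P.blockSubdiff (y (k + 1))
  step_z : ∀ k, ‖P.G (x k) - P.b + σ • P.G (P.residual (y (k + 1)) (z (k + 1)))‖ ≤ ε k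
  step_x : ∀ k, x (k + 1) = x k + (τ * σ) • P.residual (y (k + 1)) (z (k + 1))

/-- The curvature and positivity conditions under which the inexact proximal ADMM converges. -/
structure IsAdmissible (P : Problem X Y Z) (S N : PiLp 2 Y →ₗ[ℝ] PiLp 2 Y) (σ τ μ : ℝ) :
    Prop where
  σ_pos : 0 < σ
  τ_pos : 0 < τ
  τ_lt : τ < 2
  μ_nonneg : 0 ≤ μ
  major : P.IsMajorizing S
  N_symm : N.IsSymmetric
  N_nonneg : ∀ v, 0 ≤ ⟪v, N v⟫ - 1 / 2 * ⟪v, S v⟫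
  pos : ∀ v, v ≠ 0 →
    0 < ⟪v, N v⟫ - 1 / 2 * ⟪v, S v⟫ + σ * ‖LinearMap.adjoint P.F v‖ ^ 2 + μ * ‖v‖ ^ 2
  mono : ∀ {v g v' g'}, g ∈ P.blockSubdiff v → g' ∈ P.blockSubdiff v' →
    μ * ‖v - v'‖ ^ 2 ≤ ⟪g - g', v - v'⟫

section Reduction

variable {P : Problem X Y Z} {S N : PiLp 2 Y →ₗ[ℝ] PiLp 2 Y} {σ τ μ : ℝ}
  {ε : ℕ → ℝ} {δ : ℕ → PiLp 2 Y} {x : ℕ → X} {y : ℕ → PiLp 2 Y} {z : ℕ → Z}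

/-- The new value of `G x - b` is `1 - τ` times the old one plus `τ` times the `z`-step error, a
contraction for `0 < τ < 2`. -/
theorem IsInexactProxADMM.summable_dual_residual (h : P.IsInexactProxADMM N σ τ ε δ x y z)
    (hτ : 0 < τ) (hτ2 : τ < 2) : Summable fun k => ‖P.G (x k) - P.b‖ := by
  refine summable_of_succ_le_mul_add (q := |1 - τ|) (e := fun k => τ * ε k)
    (abs_lt.2 ⟨by linarith, by linarith⟩) (fun _ => norm_nonneg _)
    (fun k => mul_nonneg hτ.le (h.tol_nonneg k)) (h.tol_summable.mul_left _) (fun k => ?_)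
  have h1 : P.G (x (k + 1)) - P.b = (1 - τ) • (P.G (x k) - P.b)
      + τ • (P.G (x k) - P.b + σ • P.G (P.residual (y (k + 1)) (z (k + 1)))) := by
    rw [h.step_x k, map_add, map_smul]
    module
  rw [h1]
  refine (norm_add_le _ _).trans ?_
  rw [norm_smul, norm_smul, Real.norm_eq_abs, Real.norm_of_nonneg hτ.le]
  linarith [mul_le_mul_of_nonneg_left (h.step_z k) hτ.le]

theorem IsInexactProxADMM.summable_map_residual (h : P.IsInexactProxADMM N σ τ ε δ x y z)
    (hσ : 0 < σ) (hτ : 0 < τ) (hτ2 : τ < 2) :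
    Summable fun k => ‖P.G (P.residual (y (k + 1)) (z (k + 1)))‖ := by
  have h1 := (h.tol_summable.add (h.summable_dual_residual hτ hτ2)).mul_left σ⁻¹
  refine Summable.of_nonneg_of_le (fun _ => norm_nonneg _) (fun k => ?_) h1
  rw [inv_mul_eq_div, le_div_iff₀ hσ]
  have h2 : σ • P.G (P.residual (y (k + 1)) (z (k + 1)))
      = (P.G (x k) - P.b + σ • P.G (P.residual (y (k + 1)) (z (k + 1))))
        - (P.G (x k) - P.b) := by abel
  have h3 := congrArg norm h2
  rw [norm_smul, Real.norm_of_nonneg hσ.le] at h3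
  linarith [h.step_z k, norm_sub_le
    (P.G (x k) - P.b + σ • P.G (P.residual (y (k + 1)) (z (k + 1)))) (P.G (x k) - P.b)]

/-- The orthogonal projection onto the kernel of `G`. -/
def kerProj (P : Problem X Y Z) : X →ₗ[ℝ] X := (LinearMap.ker P.G).starProjection.toLinearMap

theorem kerProj_kerProj (P : Problem X Y Z) (v : X) : P.kerProj (P.kerProj v) = P.kerProj v :=
  Submodule.starProjection_eq_self_iff.2 (Submodule.starProjection_apply_mem _ v)

theorem inner_kerProj (P : Problem X Y Z) (v w : X) : ⟪P.kerProj v, w⟫ = ⟪v, P.kerProj w⟫ :=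
  Submodule.inner_starProjection_left_eq_right _ v w

theorem kerProj_adjoint (P : Problem X Y Z) (w : Z) :
    P.kerProj (LinearMap.adjoint P.G w) = 0 := starProjection_ker_adjoint _ _

theorem map_kerProj (P : Problem X Y Z) (v : X) : P.G (P.kerProj v) = 0 :=
  map_starProjection_ker _ _

theorem kerProj_residual (P : Problem X Y Z) (v : PiLp 2 Y) (w : Z) :
    P.kerProj (P.residual v w) = P.kerProj (LinearMap.adjoint P.F v) - P.kerProj P.c := by
  rw [residual, map_sub, map_add, kerProj_adjoint, add_zero]

theorem inner_kerProj_self (P : Problem X Y Z) (v : X) : ⟪v, P.kerProj v⟫ = ‖P.kerProj v‖ ^ 2 := by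
  rw [← real_inner_self_eq_norm_sq, P.inner_kerProj v (P.kerProj v), kerProj_kerProj]

theorem norm_sq_kerProj_add (P : Problem X Y Z) (v : X) :
    ‖P.kerProj v‖ ^ 2 + ‖v - P.kerProj v‖ ^ 2 = ‖v‖ ^ 2 := by
  rw [norm_sub_sq_real, inner_kerProj_self]
  ring

theorem adjoint_kerProj_comp (P : Problem X Y Z) (v : X) :
    LinearMap.adjoint (P.kerProj ∘ₗ LinearMap.adjoint P.F) v = P.F (P.kerProj v) := by
  apply ext_inner_right ℝ
  intro w
  rw [LinearMap.adjoint_inner_left, LinearMap.comp_apply, ← inner_kerProj,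
    LinearMap.adjoint_inner_right]

/-- The proximal operator of the method with the variable `z` eliminated. -/
def reducedProx (P : Problem X Y Z) (N : PiLp 2 Y →ₗ[ℝ] PiLp 2 Y) (σ : ℝ) :
    PiLp 2 Y →ₗ[ℝ] PiLp 2 Y :=
  N + σ • (P.F ∘ₗ (LinearMap.id - P.kerProj) ∘ₗ LinearMap.adjoint P.F)

theorem reducedProx_apply (P : Problem X Y Z) (N : PiLp 2 Y →ₗ[ℝ] PiLp 2 Y) (σ : ℝ)
    (v : PiLp 2 Y) : P.reducedProx N σ v
      = N v + σ • P.F (LinearMap.adjoint P.F v - P.kerProj (LinearMap.adjoint P.F v)) := rfl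

theorem inner_reducedProx (P : Problem X Y Z) (N : PiLp 2 Y →ₗ[ℝ] PiLp 2 Y) (σ : ℝ)
    (v w : PiLp 2 Y) : ⟪v, P.reducedProx N σ w⟫ = ⟪v, N w⟫
      + σ * (⟪LinearMap.adjoint P.F v, LinearMap.adjoint P.F w⟫
        - ⟪LinearMap.adjoint P.F v, P.kerProj (LinearMap.adjoint P.F w)⟫) := by
  rw [reducedProx_apply, inner_add_right, real_inner_smul_right,
    ← LinearMap.adjoint_inner_left P.F, inner_sub_right]

theorem inner_reducedProx_self (P : Problem X Y Z) (N : PiLp 2 Y →ₗ[ℝ] PiLp 2 Y) (σ : ℝ)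
    (v : PiLp 2 Y) : ⟪v, P.reducedProx N σ v⟫ = ⟪v, N v⟫
      + σ * (‖LinearMap.adjoint P.F v‖ ^ 2 - ‖P.kerProj (LinearMap.adjoint P.F v)‖ ^ 2) := by
  rw [inner_reducedProx, real_inner_self_eq_norm_sq, inner_kerProj_self]

/-- Eliminating `z` turns the proximal ADMM into a proximal augmented Lagrangian method. -/
theorem IsInexactProxADMM.isInexactProxALM (h : P.IsInexactProxADMM N σ τ ε δ x y z)
    (hA : P.IsAdmissible S N σ τ μ) {x' : X} (hx' : P.G x' = P.b) :
    ∃ d, IsInexactProxALM P.blockSubdiff (fun v => ∇ P.f v + P.F (x' - P.kerProj x'))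
      (P.kerProj ∘ₗ LinearMap.adjoint P.F) (P.kerProj P.c) S (P.reducedProx N σ) σ τ μ d
      (fun k => y (k + 1)) (fun k => P.kerProj (x (k + 1))) := by
  have hσ := hA.σ_pos
  -- This is the multiplier argument of the `y`-step, measured from `x'`. Its part outside `ker G`
  -- is controlled by `G ρ`, hence summable, and goes into the error `d`; the constant part `x' - Q
  -- x'` goes into `B`. Indices are shifted by one because no `z`-step precedes the initial pair.
  set ρ : ℕ → X := fun k => (x (k + 1) - x') + σ • P.residual (y (k + 1)) (z (k + 1)) with hρ
  refine ⟨fun k => δ (k + 1) - P.F (ρ k - P.kerProj (ρ k)), ?_⟩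
  have hsum : Summable fun k => ‖P.F (ρ k - P.kerProj (ρ k))‖ := by
    obtain ⟨C, hC, hle⟩ := exists_norm_sub_starProjection_ker_le P.G
    set F' := LinearMap.toContinuousLinearMap P.F
    have h1 := (((summable_nat_add_iff 1).2 (h.summable_dual_residual hA.τ_pos hA.τ_lt)).add
      ((h.summable_map_residual hσ hA.τ_pos hA.τ_lt).mul_left σ)).mul_left (‖F'‖ * C)
    refine Summable.of_nonneg_of_le (fun _ => norm_nonneg _) (fun k => ?_) h1
    have h2 : ‖P.F (ρ k - P.kerProj (ρ k))‖ ≤ ‖F'‖ * ‖ρ k - P.kerProj (ρ k)‖ := F'.le_opNorm _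
    have h3 : ‖P.G (ρ k)‖ ≤ ‖P.G (x (k + 1)) - P.b‖
        + σ * ‖P.G (P.residual (y (k + 1)) (z (k + 1)))‖ := by
      rw [hρ, map_add, map_sub, hx', map_smul]
      refine (norm_add_le _ _).trans ?_
      rw [norm_smul, Real.norm_of_nonneg hσ.le]
    calc _ ≤ ‖F'‖ * ‖ρ k - P.kerProj (ρ k)‖ := h2
      _ ≤ ‖F'‖ * (C * ‖P.G (ρ k)‖) := by
        gcongr
        exact hle _
      _ ≤ ‖F'‖ * (C * (‖P.G (x (k + 1)) - P.b‖
        + σ * ‖P.G (P.residual (y (k + 1)) (z (k + 1)))‖)) := by gcongr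
      _ = _ := by ring
  refine
    { σ_pos := hσ
      τ_pos := hA.τ_pos
      τ_lt := hA.τ_lt
      μ_nonneg := hA.μ_nonneg
      mono := hA.mono
      closed := P.mem_blockSubdiff_of_tendsto
      cont := P.continuous_gradient.add continuous_const
      coco := fun u v w => ?_
      S_nonneg := fun v => ?_
      W_symm := fun v w => ?_
      V_nonneg := fun v => ?_
      V_pos := fun v hv => ?_
      step := fun k => ?_
      u_succ := fun k => ?_
      summable := ?_ }
  · rw [add_sub_add_right_eq_sub]
    exact neg_le_inner_gradient_sub P.f_convex P.differentiable_f hA.major.2 u v w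
  · exact hA.major.1.inner_nonneg_right v
  · have h1 : ⟪w, N v⟫ = ⟪v, N w⟫ := (real_inner_comm _ _).trans (hA.N_symm v w)
    have h2 : ⟪LinearMap.adjoint P.F w, P.kerProj (LinearMap.adjoint P.F v)⟫
        = ⟪LinearMap.adjoint P.F v, P.kerProj (LinearMap.adjoint P.F w)⟫ := by
      rw [← inner_kerProj, real_inner_comm]
    rw [real_inner_comm, inner_reducedProx, inner_reducedProx, h1, h2,
      real_inner_comm (LinearMap.adjoint P.F v)]
  · rw [inner_reducedProx_self]
    have h1 := P.norm_sq_kerProj_add (LinearMap.adjoint P.F v)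
    have h2 : 0 ≤ σ * (‖LinearMap.adjoint P.F v‖ ^ 2
        - ‖P.kerProj (LinearMap.adjoint P.F v)‖ ^ 2) :=
      mul_nonneg hσ.le (by rw [← h1]; simp)
    linarith [hA.N_nonneg v]
  -- The penalty `σ ‖F* v‖²` is merely split between the new proximal operator and the new
  -- constraint map, so `V_pos` is `pos` again.
  · rw [inner_reducedProx_self, LinearMap.comp_apply]
    linarith [hA.pos v hv]
  · convert h.step_y (k + 1) using 1
    have h1 : P.residual (y (k + 1 + 1)) (z (k + 1))
        = P.residual (y (k + 1)) (z (k + 1)) + LinearMap.adjoint P.F (y (k + 1 + 1) - y (k + 1)) := by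
      rw [residual, residual, map_sub]
      abel
    have h2 := P.kerProj_residual (y (k + 1)) (z (k + 1))
    rw [adjoint_kerProj_comp, reducedProx_apply, hρ, h1]
    simp only [LinearMap.comp_apply, map_add, map_sub, map_smul, kerProj_kerProj, h2]
    module
  · rw [LinearMap.comp_apply, h.step_x (k + 1), map_add, map_smul, kerProj_residual]
  · exact Summable.of_nonneg_of_le (fun _ => norm_nonneg _) (fun k => norm_sub_le _ _)
      (((summable_nat_add_iff 1).2 h.err_summable).add hsum)

theorem IsInexactProxADMM.tendsto_core (h : P.IsInexactProxADMM N σ τ ε δ x y z)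
    (hA : P.IsAdmissible S N σ τ μ) (hne : P.kktSet.Nonempty) :
    ∃ (x' : X) (y' : PiLp 2 Y) (z' : Z), P.IsKKT x' y' z' ∧ P.projRange z' = z' ∧
      Tendsto x atTop (𝓝 x') ∧ Tendsto y atTop (𝓝 y') ∧
      Tendsto (fun k => LinearMap.adjoint P.G (z k)) atTop (𝓝 (LinearMap.adjoint P.G z')) ∧
      Tendsto (fun k => P.residual (y k) (z k)) atTop (𝓝 0) := by
  obtain ⟨_, x₀, y₀, z₀, -, hKKT₀⟩ := hne
  rw [isKKT_iff] at hKKT₀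
  obtain ⟨hg₀, hG₀, hr₀⟩ := hKKT₀
  obtain ⟨d, hd⟩ := h.isInexactProxALM hA hG₀
  obtain ⟨y', u', ⟨hg, hy'⟩, hy, hu⟩ := hd.tendsto_saddle ⟨y₀, P.kerProj x₀, by
    refine ⟨?_, ?_⟩
    · rw [adjoint_kerProj_comp, kerProj_kerProj]
      convert hg₀ using 1
      rw [map_sub]
      module
    · have := P.kerProj_residual y₀ z₀
      rw [hr₀, map_zero] at this
      exact (sub_eq_zero.1 this.symm)⟩
  rw [adjoint_kerProj_comp] at hg
  rw [LinearMap.comp_apply] at hy'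
  have hQc : Continuous P.kerProj := P.kerProj.continuous_of_finiteDimensional
  have hFc : Continuous (LinearMap.adjoint P.F) :=
    (LinearMap.adjoint P.F).continuous_of_finiteDimensional
  have hGc : Continuous P.G := P.G.continuous_of_finiteDimensional
  obtain ⟨C, hC, hle⟩ := exists_norm_sub_starProjection_ker_le P.G
  have hu' : P.kerProj u' = u' := by
    refine tendsto_nhds_unique ((hQc.tendsto _).comp hu) ?_
    refine hu.congr fun k => ?_
    rw [Function.comp_apply, kerProj_kerProj]
  -- The part of `x` in `ker G` is the multiplier of the reduced method. The orthogonal part tends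
  -- to that of `x₀`, since `G x → b = G x₀`.
  have hx : Tendsto x atTop (𝓝 (u' + (x₀ - P.kerProj x₀))) := by
    rw [← tendsto_add_atTop_iff_nat 1]
    have h1 : Tendsto (fun k => (x (k + 1) - x₀) - P.kerProj (x (k + 1) - x₀)) atTop (𝓝 0) := by
      have h2 := ((tendsto_add_atTop_iff_nat 1).2
        (h.summable_dual_residual hA.τ_pos hA.τ_lt).tendsto_atTop_zero).const_mul C
      rw [mul_zero] at h2
      refine squeeze_zero_norm (fun k => ?_) h2
      have h3 := hle (x (k + 1) - x₀)
      rwa [map_sub P.G, hG₀] at h3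
    have h2 := (h1.add hu).add_const (x₀ - P.kerProj x₀)
    rw [zero_add] at h2
    refine h2.congr fun k => ?_
    rw [map_sub]
    abel
  have hy0 : Tendsto y atTop (𝓝 y') := (tendsto_add_atTop_iff_nat 1).1 hy
  have hr : Tendsto (fun k => P.residual (y k) (z k)) atTop (𝓝 0) := by
    rw [← tendsto_add_atTop_iff_nat 1]
    have h1 : Tendsto (fun k => P.residual (y (k + 1)) (z (k + 1))
        - P.kerProj (P.residual (y (k + 1)) (z (k + 1)))) atTop (𝓝 0) := by
      have h2 := (h.summable_map_residual hA.σ_pos hA.τ_pos hA.τ_lt).tendsto_atTop_zero.const_mul C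
      rw [mul_zero] at h2
      exact squeeze_zero_norm (fun k => hle _) h2
    have h2 : Tendsto (fun k => P.kerProj (P.residual (y (k + 1)) (z (k + 1)))) atTop (𝓝 0) := by
      simp only [kerProj_residual]
      have h3 := ((hQc.tendsto _).comp ((hFc.tendsto _).comp hy)).sub_const (P.kerProj P.c)
      rw [hy', sub_self] at h3
      exact h3
    simpa using h1.add h2
  have hz : Tendsto (fun k => LinearMap.adjoint P.G (z k)) atTop
      (𝓝 (P.c - LinearMap.adjoint P.F y')) := by
    have h1 := (hr.add_const P.c).sub ((hFc.tendsto _).comp hy0)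
    rw [zero_add] at h1
    refine h1.congr fun k => ?_
    rw [residual, Function.comp_apply]
    abel
  -- The range of `G*` is closed, so the limit of `G* z` is attained; projecting `z₁` onto `Range G`
  -- normalizes the choice.
  obtain ⟨z₁, hz₁⟩ := exists_adjoint_eq_of_tendsto hz
  have hz' : LinearMap.adjoint P.G (P.projRange z₁) = P.c - LinearMap.adjoint P.F y' := by
    rw [projRange, adjoint_starProjection_range, hz₁]
  refine ⟨_, y', P.projRange z₁, ?_, ?_, hx, hy0, by rwa [hz'], hr⟩
  · rw [isKKT_iff]
    refine ⟨?_, ?_, ?_⟩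
    · rw [hu'] at hg
      convert hg using 1
      change _ = -(∇ P.f y' + P.F (x₀ - P.kerProj x₀)) - P.F u'
      rw [map_add]
      module
    · rw [map_add, map_sub, map_kerProj, ← hu', map_kerProj, hG₀]
      abel
    · rw [residual, hz']
      abel
  · exact Submodule.starProjection_eq_self_iff.2 (Submodule.starProjection_apply_mem _ _)

theorem tendsto_infDist_kktSet {x' : X} {y' : PiLp 2 Y} {z' : Z} (hKKT : P.IsKKT x' y' z')
    (hx : Tendsto x atTop (𝓝 x')) (hy : Tendsto y atTop (𝓝 y'))
    (hz : Tendsto (fun k => P.projRange (z k)) atTop (𝓝 z')) :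
    Tendsto (fun k => Metric.infDist (triple (x k) (y k) (z k)) P.kktSet) atTop (𝓝 0) := by
  have hc : Continuous (fun p : X × PiLp 2 Y × Z => ‖triple p.1 p.2.1 p.2.2‖) := by
    unfold triple
    fun_prop
  have h1 := (hc.tendsto _).comp ((hx.sub_const x').prodMk_nhds
    ((hy.sub_const y').prodMk_nhds (hz.sub_const z')))
  have h2 : ‖triple (x' - x') (y' - y') (z' - z')‖ = 0 := by
    simp only [sub_self]
    exact norm_zero
  simp only [h2] at h1
  refine squeeze_zero (fun _ => Metric.infDist_nonneg) (fun k => ?_) h1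
  -- The comparison point copies the component of `z k` in `ker G*`, which may be unbounded but does
  -- not affect the KKT system.
  have hmem : triple x' y' (z k - P.projRange (z k) + z') ∈ P.kktSet := by
    refine ⟨_, _, _, rfl, hKKT.congr_adjoint ?_⟩
    rw [map_add, map_sub, projRange, adjoint_starProjection_range, sub_self, zero_add]
  refine (Metric.infDist_le_dist_of_mem hmem).trans ?_
  rw [dist_eq_norm]
  have h3 : triple (x k) (y k) (z k) - triple x' y' (z k - P.projRange (z k) + z')
      = triple (x k - x') (y k - y') (P.projRange (z k) - z') := by
    have : P.projRange (z k) - z' = z k - (z k - P.projRange (z k) + z') := by abel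
    rw [this]
    rfl
  rw [h3]
  rfl

theorem projRange_eq_self (hG : Function.Surjective P.G) (w : Z) : P.projRange w = w := by
  refine Submodule.starProjection_eq_self_iff.2 ?_
  rw [LinearMap.range_eq_top.2 hG]
  exact Submodule.mem_top

theorem IsInexactProxADMM.convergence (h : P.IsInexactProxADMM N σ τ ε δ x y z)
    (hA : P.IsAdmissible S N σ τ μ) (hne : P.kktSet.Nonempty) :
    (∃ (x' : X) (y' : PiLp 2 Y) (z' : Z),
      Tendsto (fun k => (x k, y k, P.projRange (z k))) atTop (𝓝 (x', y', z')) ∧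
      P.IsKKT x' y' z' ∧ P.IsSolution y' z' ∧ P.IsDualSolution x') ∧
    (∀ (y' : PiLp 2 Y) (z' : Z),
      MapClusterPt (y', z') atTop (fun k => (y k, z k)) → P.IsSolution y' z') ∧
    Tendsto (fun k => P.objective (y k) (z k)) atTop (𝓝 P.optValue) ∧
    Tendsto (fun k => P.residual (y k) (z k)) atTop (𝓝 0) ∧
    Tendsto (fun k => Metric.infDist (triple (x k) (y k) (z k)) P.kktSet) atTop (𝓝 0) ∧
    (Function.Surjective P.G →
      ∃ (x' : X) (y' : PiLp 2 Y) (z' : Z),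
        Tendsto (fun k => (x k, y k, z k)) atTop (𝓝 (x', y', z')) ∧ P.IsKKT x' y' z') := by
  obtain ⟨x', y', z', hKKT, hz', hx, hy, hGz, hr⟩ := h.tendsto_core hA hne
  have hz : Tendsto (fun k => P.projRange (z k)) atTop (𝓝 z') := by
    have := tendsto_starProjection_range hGz
    change Tendsto (fun k => P.projRange (z k)) atTop (𝓝 (P.projRange z')) at this
    rwa [hz'] at this
  have hall := hx.prodMk_nhds (hy.prodMk_nhds hz)
  refine ⟨⟨x', y', z', hall, hKKT, hKKT.isSolution, hKKT.isDualSolution⟩, ?_, ?_, hr,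
    tendsto_infDist_kktSet hKKT hx hy hz, ?_⟩
  · intro y₁ z₁ hcl
    have hGc : Continuous (LinearMap.adjoint P.G) :=
      (LinearMap.adjoint P.G).continuous_of_finiteDimensional
    have h3 : y₁ = y' := mapClusterPt_map_eq (f := fun p : PiLp 2 Y × Z => p.1) continuous_fst hcl hy
    have h4 : LinearMap.adjoint P.G z₁ = LinearMap.adjoint P.G z' :=
      mapClusterPt_map_eq (f := fun p : PiLp 2 Y × Z => LinearMap.adjoint P.G p.2)
        (hGc.comp continuous_snd) hcl hGz
    rw [h3]
    exact (hKKT.congr_adjoint h4).isSolution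
  -- Only iterates produced by a `y`-step come with a subgradient, so the argument starts at index
  -- one.
  · rw [← tendsto_add_atTop_iff_nat 1]
    have hFc : Continuous P.F := P.F.continuous_of_finiteDimensional
    have hFc' : Continuous (LinearMap.adjoint P.F) :=
      (LinearMap.adjoint P.F).continuous_of_finiteDimensional
    have hNc : Continuous N := N.continuous_of_finiteDimensional
    have hy1 := (tendsto_add_atTop_iff_nat 1).2 hy
    have hΔ := hy1.sub hy
    rw [sub_self] at hΔ
    have hr1 : Tendsto (fun k => P.residual (y (k + 1)) (z k)) atTop (𝓝 0) := by
      have h1 := hr.add ((hFc'.tendsto _).comp hΔ)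
      rw [map_zero, add_zero] at h1
      refine h1.congr fun k => ?_
      rw [residual, residual, Function.comp_apply, map_sub]
      abel
    have hδ := tendsto_zero_iff_norm_tendsto_zero.2 h.err_summable.tendsto_atTop_zero
    have hg := (((hδ.sub ((P.continuous_gradient.tendsto _).comp hy)).sub
      ((hFc.tendsto _).comp hx)).sub (((hFc.tendsto _).comp hr1).const_smul σ)).sub
      ((hNc.tendsto _).comp hΔ)
    exact P.tendsto_objective hKKT hy1 ((tendsto_add_atTop_iff_nat 1).2 hGz) hg h.step_y
  · intro hG
    refine ⟨x', y', z', ?_, hKKT⟩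
    simpa only [projRange_eq_self hG] using hall

end Reduction

end Problem

/-! ### Inverses of definite operators and block triangular splittings. -/

theorem IsPosDef.exists_inverse {V : Type*} [NormedAddCommGroup V] [InnerProductSpace ℝ V]
    [FiniteDimensional ℝ V] {A : V →ₗ[ℝ] V} (hA : IsPosDef A) :
    ∃ B : V →ₗ[ℝ] V, (∀ v, B (A v) = v) ∧ B.IsSymmetric ∧ IsPosDef B := by
  have hinj : Function.Injective A := by
    rw [← LinearMap.ker_eq_bot, LinearMap.ker_eq_bot']
    intro v hv
    by_contra hne
    have := hA.2 v hne
    rw [hv, inner_zero_left] at this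
    exact lt_irrefl _ this
  set e := LinearEquiv.ofInjectiveEndo A hinj
  have h1 : ∀ v, A (e.symm v) = v := fun v => e.apply_symm_apply v
  have hs : (e.symm : V →ₗ[ℝ] V).IsSymmetric := by
    intro v w
    have := hA.1 (e.symm v) (e.symm w)
    rw [h1, h1] at this
    exact this.symm
  refine ⟨e.symm, fun v => e.symm_apply_apply v, hs, hs, fun v hv => ?_⟩
  have hne : e.symm v ≠ 0 := by simpa using hv
  have := hA.2 _ hne
  rw [h1, real_inner_comm] at this
  exact this

section Blocks

variable {m : ℕ} {Y : Fin (m + 1) → Type*} [∀ i, NormedAddCommGroup (Y i)]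
  [∀ i, InnerProductSpace ℝ (Y i)]

theorem sum_incl (v : PiLp 2 Y) : ∑ i, incl i (v i) = v := by
  ext j
  rw [WithLp.ofLp_sum, Finset.sum_apply, Finset.sum_eq_single j]
  · exact incl_apply_same j (v j)
  · intro i _ hi
    exact incl_apply_ne hi.symm (v i)
  · simp

theorem norm_incl (i : Fin (m + 1)) (v : Y i) : ‖incl i v‖ = ‖v‖ := by
  rw [← sq_eq_sq₀ (norm_nonneg _) (norm_nonneg _), ← real_inner_self_eq_norm_sq, inner_incl_left,
    incl_apply_same, real_inner_self_eq_norm_sq]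

theorem norm_le_sum_norm (v : PiLp 2 Y) : ‖v‖ ≤ ∑ i, ‖v i‖ := by
  conv_lhs => rw [← sum_incl v]
  refine (norm_sum_le _ _).trans_eq ?_
  simp only [norm_incl]

theorem map_apply_eq_sum_block (A : PiLp 2 Y →ₗ[ℝ] PiLp 2 Y) (v : PiLp 2 Y) (i : Fin (m + 1)) :
    A v i = ∑ j, block A i j (v j) := by
  conv_lhs => rw [← sum_incl v, map_sum, WithLp.ofLp_sum, Finset.sum_apply]
  rfl

theorem inner_block (A : PiLp 2 Y →ₗ[ℝ] PiLp 2 Y) (i j : Fin (m + 1)) (v : Y j) (w : Y i) :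
    ⟪block A i j v, w⟫ = ⟪A (incl j v), incl i w⟫ :=
  (inner_incl_right i w _).symm

theorem blockDiag_apply (D : ∀ i, Y i →ₗ[ℝ] Y i) (v : PiLp 2 Y) (i : Fin (m + 1)) :
    blockDiag D v i = D i (v i) := by
  rw [blockDiag, LinearMap.sum_apply, WithLp.ofLp_sum, Finset.sum_apply, Finset.sum_eq_single i]
  · exact incl_apply_same i _
  · intro j _ hj
    exact incl_apply_ne hj.symm _
  · simp

theorem inner_blockDiag (D : ∀ i, Y i →ₗ[ℝ] Y i) (v w : PiLp 2 Y) :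
    ⟪blockDiag D v, w⟫ = ∑ i, ⟪D i (v i), w i⟫ := by
  rw [PiLp.inner_apply]
  simp only [blockDiag_apply]

theorem blockDiag_isSymmetric {D : ∀ i, Y i →ₗ[ℝ] Y i} (hD : ∀ i, (D i).IsSymmetric) :
    (blockDiag D).IsSymmetric := by
  intro v w
  rw [real_inner_comm (blockDiag D w), inner_blockDiag, inner_blockDiag]
  exact Finset.sum_congr rfl fun i _ => (hD i _ _).trans (real_inner_comm _ _)

theorem blockDiag_incl (D : ∀ i, Y i →ₗ[ℝ] Y i) (i : Fin (m + 1)) (v : Y i) :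
    blockDiag D (incl i v) = incl i (D i v) := by
  ext j
  rw [blockDiag_apply]
  by_cases hj : j = i
  · subst hj
    rw [incl_apply_same, incl_apply_same]
  · rw [incl_apply_ne hj, incl_apply_ne hj, map_zero]

theorem mix_apply_lt (a b : PiLp 2 Y) {i j : Fin (m + 1)} (v : Y i) (h : j < i) :
    mix a b i v j = a j := by
  change Function.update (fun j => if j < i then a j else b j) i v j = a j
  rw [Function.update_of_ne h.ne, if_pos h]

theorem mix_apply_gt (a b : PiLp 2 Y) {i j : Fin (m + 1)} (v : Y i) (h : i < j) :
    mix a b i v j = b j := by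
  change Function.update (fun j => if j < i then a j else b j) i v j = b j
  rw [Function.update_of_ne h.ne', if_neg h.not_gt]

theorem mix_apply_same (a b : PiLp 2 Y) (i : Fin (m + 1)) (v : Y i) : mix a b i v i = v := by
  change Function.update (fun j => if j < i then a j else b j) i v i = v
  rw [Function.update_self]

theorem mix_add_smul (a b : PiLp 2 Y) (i : Fin (m + 1)) (v w : Y i) (t : ℝ) :
    mix a b i (v + t • w) = mix a b i v + t • incl i w := by
  ext j
  rw [PiLp.add_apply, PiLp.smul_apply]
  rcases lt_trichotomy j i with h | h | h
  · rw [mix_apply_lt _ _ _ h, mix_apply_lt _ _ _ h, incl_apply_ne h.ne, smul_zero, add_zero]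
  · subst h
    rw [mix_apply_same, mix_apply_same, incl_apply_same]
  · rw [mix_apply_gt _ _ _ h, mix_apply_gt _ _ _ h, incl_apply_ne h.ne', smul_zero, add_zero]

theorem mix_sub (a b c : PiLp 2 Y) (i : Fin (m + 1)) (v : Y i) :
    mix a b i v - c = mix (a - c) (b - c) i (v - c i) := by
  ext j
  rw [PiLp.sub_apply]
  rcases lt_trichotomy j i with h | h | h
  · rw [mix_apply_lt _ _ _ h, mix_apply_lt _ _ _ h, PiLp.sub_apply]
  · subst h
    rw [mix_apply_same, mix_apply_same]
  · rw [mix_apply_gt _ _ _ h, mix_apply_gt _ _ _ h, PiLp.sub_apply]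

/-- The strictly block lower triangular part of an operator. -/
def lowerPart (A : PiLp 2 Y →ₗ[ℝ] PiLp 2 Y) : PiLp 2 Y →ₗ[ℝ] PiLp 2 Y :=
  ∑ i, ∑ j, if j < i then incl i ∘ₗ block A i j ∘ₗ proj j else 0

/-- The strictly block upper triangular part of an operator. -/
def upperPart (A : PiLp 2 Y →ₗ[ℝ] PiLp 2 Y) : PiLp 2 Y →ₗ[ℝ] PiLp 2 Y :=
  ∑ i, ∑ j, if i < j then incl i ∘ₗ block A i j ∘ₗ proj j else 0

theorem sum_incl_comp_apply (B : ∀ i j : Fin (m + 1), Y j →ₗ[ℝ] Y i)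
    (r : Fin (m + 1) → Fin (m + 1) → Prop) [∀ i j, Decidable (r i j)] (v : PiLp 2 Y)
    (i : Fin (m + 1)) :
    (∑ i, ∑ j, if r i j then incl i ∘ₗ B i j ∘ₗ proj j else 0 : PiLp 2 Y →ₗ[ℝ] PiLp 2 Y) v i
      = ∑ j, if r i j then B i j (v j) else 0 := by
  rw [LinearMap.sum_apply, WithLp.ofLp_sum, Finset.sum_apply, Finset.sum_eq_single i]
  · rw [LinearMap.sum_apply, WithLp.ofLp_sum, Finset.sum_apply]
    refine Finset.sum_congr rfl fun j _ => ?_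
    split_ifs
    · exact incl_apply_same i _
    · rfl
  · intro k _ hk
    rw [LinearMap.sum_apply, WithLp.ofLp_sum, Finset.sum_apply]
    refine Finset.sum_eq_zero fun j _ => ?_
    split_ifs
    · exact incl_apply_ne hk.symm _
    · rfl
  · simp

theorem lowerPart_apply (A : PiLp 2 Y →ₗ[ℝ] PiLp 2 Y) (v : PiLp 2 Y) (i : Fin (m + 1)) :
    lowerPart A v i = ∑ j, if j < i then block A i j (v j) else 0 :=
  sum_incl_comp_apply (fun i j => block A i j) (fun i j => j < i) v i

theorem upperPart_apply (A : PiLp 2 Y →ₗ[ℝ] PiLp 2 Y) (v : PiLp 2 Y) (i : Fin (m + 1)) :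
    upperPart A v i = ∑ j, if i < j then block A i j (v j) else 0 :=
  sum_incl_comp_apply (fun i j => block A i j) (fun i j => i < j) v i

theorem inner_upperPart {A : PiLp 2 Y →ₗ[ℝ] PiLp 2 Y} (hA : A.IsSymmetric) (v w : PiLp 2 Y) :
    ⟪upperPart A v, w⟫ = ⟪v, lowerPart A w⟫ := by
  rw [PiLp.inner_apply, PiLp.inner_apply]
  simp only [upperPart_apply, lowerPart_apply, sum_inner, inner_sum]
  rw [Finset.sum_comm]
  refine Finset.sum_congr rfl fun i _ => Finset.sum_congr rfl fun j _ => ?_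
  split_ifs
  · rw [inner_block, hA, real_inner_comm, ← inner_block, real_inner_comm]
  · rw [inner_zero_left, inner_zero_right]

/-- This puts a Gauss-Seidel sweep into operator form: the blocks before `i` act through the lower
part, those after `i` through the upper part. -/
theorem map_mix_apply (A : PiLp 2 Y →ₗ[ℝ] PiLp 2 Y) (a b : PiLp 2 Y) (i : Fin (m + 1)) (v : Y i) :
    A (mix a b i v) i = lowerPart A a i + block A i i v + upperPart A b i := by
  have h1 : block A i i v = ∑ j, if j = i then block A i j (mix a b i v j) else 0 := by
    rw [Finset.sum_ite_eq' Finset.univ i, if_pos (Finset.mem_univ i), mix_apply_same]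
  rw [map_apply_eq_sum_block, lowerPart_apply, upperPart_apply, h1, ← Finset.sum_add_distrib,
    ← Finset.sum_add_distrib]
  refine Finset.sum_congr rfl fun j _ => ?_
  rcases lt_trichotomy j i with h | h | h
  · rw [if_pos h, if_neg h.ne, if_neg h.not_gt, mix_apply_lt _ _ _ h, add_zero, add_zero]
  · rw [if_neg h.not_lt, if_pos h, if_neg h.symm.not_lt, add_zero, zero_add]
  · rw [if_neg h.not_gt, if_neg h.ne', if_pos h, mix_apply_gt _ _ _ h, zero_add, zero_add]

theorem mix_self (a : PiLp 2 Y) (i : Fin (m + 1)) : mix a a i (a i) = a := by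
  ext j
  rcases lt_trichotomy j i with h | h | h
  · rw [mix_apply_lt _ _ _ h]
  · subst h
    rw [mix_apply_same]
  · rw [mix_apply_gt _ _ _ h]

theorem map_apply_eq_parts (A : PiLp 2 Y →ₗ[ℝ] PiLp 2 Y) (v : PiLp 2 Y) (i : Fin (m + 1)) :
    A v i = lowerPart A v i + block A i i (v i) + upperPart A v i := by
  conv_lhs => rw [← mix_self v i]
  exact map_mix_apply A v v i (v i)

/-- The strict upper part never reads block `0`, which the backward sweep leaves undefined. -/
theorem upperPart_congr (A : PiLp 2 Y →ₗ[ℝ] PiLp 2 Y) {v w : PiLp 2 Y}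
    (h : ∀ i, i ≠ 0 → v i = w i) : upperPart A v = upperPart A w := by
  ext i
  rw [upperPart_apply, upperPart_apply]
  refine Finset.sum_congr rfl fun j _ => ?_
  split_ifs with hij
  · rw [h j (Fin.ne_zero_of_lt hij)]
  · rfl

end Blocks

/-! ### The majorized augmented Lagrangian and its block subproblems. -/

namespace Problem

variable {m : ℕ} {X : Type*} {Y : Fin (m + 1) → Type*} {Z : Type*}
  [NormedAddCommGroup X] [InnerProductSpace ℝ X] [FiniteDimensional ℝ X]
  [∀ i, NormedAddCommGroup (Y i)] [∀ i, InnerProductSpace ℝ (Y i)]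
  [∀ i, FiniteDimensional ℝ (Y i)]
  [NormedAddCommGroup Z] [InnerProductSpace ℝ Z] [FiniteDimensional ℝ Z]

variable (P : Problem X Y Z)

/-- The smooth part of the majorized augmented Lagrangian function. -/
def smoothPart (S : PiLp 2 Y →ₗ[ℝ] PiLp 2 Y) (σ : ℝ) (z : Z) (x : X) (y' y : PiLp 2 Y) : ℝ :=
  P.fHat S y y' - ⟪P.b, z⟫ + ⟪P.residual y z, x⟫ + σ / 2 * ‖P.residual y z‖ ^ 2

/-- The gradient with respect to `y` of the smooth part of the majorized augmented Lagrangian. -/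
def smoothGrad (S : PiLp 2 Y →ₗ[ℝ] PiLp 2 Y) (σ : ℝ) (z : Z) (x : X) (y' y : PiLp 2 Y) :
    PiLp 2 Y :=
  ∇ P.f y' + S (y - y') + P.F x + σ • P.F (P.residual y z)

theorem residual_add_smul (y w : PiLp 2 Y) (z : Z) (t : ℝ) :
    P.residual (y + t • w) z = P.residual y z + t • LinearMap.adjoint P.F w := by
  rw [residual, residual, map_add, map_smul]
  abel

theorem smoothPart_add_smul {S : PiLp 2 Y →ₗ[ℝ] PiLp 2 Y} (hS : S.IsSymmetric) (σ : ℝ) (z : Z)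
    (x : X) (y' y w : PiLp 2 Y) (t : ℝ) :
    P.smoothPart S σ z x y' (y + t • w) = P.smoothPart S σ z x y' y
      + t * ⟪P.smoothGrad S σ z x y' y, w⟫
      + t ^ 2 * (1 / 2 * ⟪w, S w⟫ + σ / 2 * ‖LinearMap.adjoint P.F w‖ ^ 2) := by
  have h1 : y + t • w - y' = (y - y') + t • w := by abel
  have h2 : ⟪y - y', S w⟫ = ⟪S (y - y'), w⟫ := (hS _ _).symm
  have h3 : ⟪w, S (y - y')⟫ = ⟪S (y - y'), w⟫ := real_inner_comm _ _
  have h4 : ⟪LinearMap.adjoint P.F w, x⟫ = ⟪P.F x, w⟫ := by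
    rw [LinearMap.adjoint_inner_left, real_inner_comm]
  have h5 : ⟪P.residual y z, LinearMap.adjoint P.F w⟫ = ⟪P.F (P.residual y z), w⟫ :=
    LinearMap.adjoint_inner_right _ _ _
  simp only [smoothPart, smoothGrad, fHat, residual_add_smul, h1, map_add, map_smul,
    inner_add_left, inner_add_right, real_inner_smul_left, real_inner_smul_right,
    norm_add_sq_real, norm_smul, mul_pow, Real.norm_eq_abs, sq_abs, h2, h3, h4, h5]
  ring

theorem smoothGrad_eq (S : PiLp 2 Y →ₗ[ℝ] PiLp 2 Y) (σ : ℝ) (z : Z) (x : X) (y' y : PiLp 2 Y) :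
    P.smoothGrad S σ z x y' y = P.smoothGrad S σ z x y' y'
      + (S + σ • (P.F ∘ₗ LinearMap.adjoint P.F)) (y - y') := by
  have h1 : P.residual y z = P.residual y' z + LinearMap.adjoint P.F (y - y') := by
    rw [residual, residual, map_sub]
    abel
  simp only [smoothGrad, sub_self, map_zero, LinearMap.add_apply, LinearMap.smul_apply,
    LinearMap.comp_apply, h1, map_add]
  module

theorem sub_smoothGrad_mem_subdiff {S : PiLp 2 Y →ₗ[ℝ] PiLp 2 Y} (hS : S.IsSymmetric) {σ : ℝ}
    {z : Z} {x : X} {y' a b : PiLp 2 Y} {v g : Y 0}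
    (hg : g ∈ subdiff (fun v => P.majAugLagrangian S σ (mix a b 0 v) z x y') v) :
    g - P.smoothGrad S σ z x y' (mix a b 0 v) 0 ∈ subdiff P.p v := by
  have heq : (fun v => P.majAugLagrangian S σ (mix a b 0 v) z x y')
      = fun v => P.p v + (P.smoothPart S σ z x y' (mix a b 0 v) : EReal) := by
    ext v
    rw [majAugLagrangian, mix_apply_same]
    rfl
  rw [heq] at hg
  refine sub_mem_subdiff_of_add P.p_closedProperConvex.ne_bot P.p_closedProperConvex.proper
    P.p_closedProperConvex.convex (fun w => ⟨1 / 2 * ⟪incl 0 w, S (incl 0 w)⟫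
      + σ / 2 * ‖LinearMap.adjoint P.F (incl 0 w)‖ ^ 2, fun t => le_of_eq ?_⟩) hg
  rw [mix_add_smul, P.smoothPart_add_smul hS, inner_incl_right]

/-- For `i ≠ 0` the nonsmooth term is a constant. It has to be finite: if it were `⊤`, every vector
would be a subgradient. -/
theorem eq_smoothGrad_of_mem_subdiff {S : PiLp 2 Y →ₗ[ℝ] PiLp 2 Y} (hS : S.IsSymmetric) {σ : ℝ}
    {z : Z} {x : X} {y' a b : PiLp 2 Y} (ha : a 0 ∈ effDomain P.p) {i : Fin (m + 1)} (hi : i ≠ 0)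
    {v g : Y i} (hg : g ∈ subdiff (fun v => P.majAugLagrangian S σ (mix a b i v) z x y') v) :
    g = P.smoothGrad S σ z x y' (mix a b i v) i := by
  have hb := P.p_closedProperConvex.ne_bot
  obtain ⟨r, hr⟩ : ∃ r : ℝ, P.p (a 0) = r := ⟨_, (coe_toReal_of_mem_effDomain hb ha).symm⟩
  have heq : (fun v => P.majAugLagrangian S σ (mix a b i v) z x y')
      = fun v => (r : EReal) + (P.smoothPart S σ z x y' (mix a b i v) : EReal) := by
    ext v
    rw [majAugLagrangian, mix_apply_lt _ _ _ (Fin.pos_of_ne_zero hi), hr]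
    rfl
  rw [heq] at hg
  have hdom : effDomain (fun _ : Y i => (r : EReal)) = Set.univ :=
    Set.eq_univ_of_forall fun _ => EReal.coe_ne_top r
  have h1 : g - P.smoothGrad S σ z x y' (mix a b i v) i
      ∈ subdiff (fun _ : Y i => (r : EReal)) v := by
    refine sub_mem_subdiff_of_add (fun _ => EReal.coe_ne_bot r) ?_ ?_
      (fun w => ⟨1 / 2 * ⟪incl i w, S (incl i w)⟫
        + σ / 2 * ‖LinearMap.adjoint P.F (incl i w)‖ ^ 2, fun t => le_of_eq ?_⟩) hg
    · rw [hdom]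
      exact Set.univ_nonempty
    · rw [hdom]
      exact convexOn_const _ convex_univ
    · rw [mix_add_smul, P.smoothPart_add_smul hS, inner_incl_right]
  set l := g - P.smoothGrad S σ z x y' (mix a b i v) i with hl
  -- A subgradient `l` of a constant, tested in its own direction, has `‖l‖² ≤ 0`.
  have h2 := h1 (v + l)
  rw [add_sub_cancel_left, real_inner_self_eq_norm_sq, ← EReal.coe_add, EReal.coe_le_coe_iff] at h2
  have h3 : ‖l‖ ^ 2 = 0 := le_antisymm (by linarith) (sq_nonneg _)
  exact sub_eq_zero.1 (norm_eq_zero.1 (pow_eq_zero_iff two_ne_zero |>.1 h3))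

theorem mem_effDomain_of_mem_subdiff_majAug {S : PiLp 2 Y →ₗ[ℝ] PiLp 2 Y} (hS : S.IsSymmetric)
    {σ : ℝ} {z : Z} {x : X} {y' a b : PiLp 2 Y} {v g : Y 0}
    (hg : g ∈ subdiff (fun v => P.majAugLagrangian S σ (mix a b 0 v) z x y') v) :
    v ∈ effDomain P.p :=
  mem_effDomain_of_mem_subdiff P.p_closedProperConvex.proper (P.sub_smoothGrad_mem_subdiff hS hg)

theorem adjoint_Fblock (i : Fin (m + 1)) (v : Y i) :
    LinearMap.adjoint (P.Fblock i) v = LinearMap.adjoint P.F (incl i v) := by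
  apply ext_inner_right ℝ
  intro w
  rw [LinearMap.adjoint_inner_left, LinearMap.adjoint_inner_left, inner_incl_left]
  rfl

end Problem

/-! ### The block symmetric Gauss-Seidel theorem. -/

namespace Problem

variable {m : ℕ} {X : Type*} {Y : Fin (m + 1) → Type*} {Z : Type*}
  [NormedAddCommGroup X] [InnerProductSpace ℝ X] [FiniteDimensional ℝ X]
  [∀ i, NormedAddCommGroup (Y i)] [∀ i, InnerProductSpace ℝ (Y i)]
  [∀ i, FiniteDimensional ℝ (Y i)]
  [NormedAddCommGroup Z] [InnerProductSpace ℝ Z] [FiniteDimensional ℝ Z]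

variable (P : Problem X Y Z)

/-- The operator `S + σ F F*`. -/
def curvature (S : PiLp 2 Y →ₗ[ℝ] PiLp 2 Y) (σ : ℝ) : PiLp 2 Y →ₗ[ℝ] PiLp 2 Y :=
  S + σ • (P.F ∘ₗ LinearMap.adjoint P.F)

theorem inner_curvature (S : PiLp 2 Y →ₗ[ℝ] PiLp 2 Y) (σ : ℝ) (v w : PiLp 2 Y) :
    ⟪P.curvature S σ v, w⟫
      = ⟪S v, w⟫ + σ * ⟪LinearMap.adjoint P.F v, LinearMap.adjoint P.F w⟫ := by
  rw [LinearMap.adjoint_inner_right, ← real_inner_smul_left, ← inner_add_left]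
  rfl

theorem curvature_isSymmetric {S : PiLp 2 Y →ₗ[ℝ] PiLp 2 Y} (hS : S.IsSymmetric) (σ : ℝ) :
    (P.curvature S σ).IsSymmetric := by
  intro v w
  rw [real_inner_comm (P.curvature S σ w), inner_curvature, inner_curvature, hS v w,
    real_inner_comm v, real_inner_comm (LinearMap.adjoint P.F v)]

/-- The `i`-th diagonal block of `S + σ F F* + diag D`. -/
def diagBlock (S : PiLp 2 Y →ₗ[ℝ] PiLp 2 Y) (D : ∀ i, Y i →ₗ[ℝ] Y i) (σ : ℝ) (i : Fin (m + 1)) :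
    Y i →ₗ[ℝ] Y i :=
  block (P.curvature S σ) i i + D i

variable {P} {S : PiLp 2 Y →ₗ[ℝ] PiLp 2 Y} {D : ∀ i, Y i →ₗ[ℝ] Y i} {σ : ℝ}

theorem inner_diagBlock (i : Fin (m + 1)) (v : Y i) :
    ⟪P.diagBlock S D σ i v, v⟫ = ⟪S (incl i v), incl i v⟫
      + σ * ‖LinearMap.adjoint P.F (incl i v)‖ ^ 2 + ⟪D i v, v⟫ := by
  rw [diagBlock, LinearMap.add_apply, inner_add_left, inner_block, inner_curvature,
    real_inner_self_eq_norm_sq]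

theorem ProximalCondition.inner_posDef (hP : P.ProximalCondition S D σ) (i : Fin (m + 1)) {v : Y i}
    (hv : v ≠ 0) : 0 < 1 / 2 * ⟪S (incl i v), incl i v⟫
      + σ * ‖LinearMap.adjoint P.F (incl i v)‖ ^ 2 + ⟪D i v, v⟫ := by
  have h1 := (hP.posDef i).2 v hv
  have h2 : ⟪P.Fblock i (LinearMap.adjoint (P.Fblock i) v), v⟫
      = ‖LinearMap.adjoint P.F (incl i v)‖ ^ 2 := by
    rw [← LinearMap.adjoint_inner_right, adjoint_Fblock, real_inner_self_eq_norm_sq]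
  rw [LinearMap.add_apply, LinearMap.add_apply, LinearMap.smul_apply, LinearMap.smul_apply,
    LinearMap.comp_apply, inner_add_left, inner_add_left, real_inner_smul_left,
    real_inner_smul_left, inner_block, h2] at h1
  exact h1

theorem ProximalCondition.inner_lower (hP : P.ProximalCondition S D σ) (v : PiLp 2 Y) :
    0 ≤ ⟪blockDiag D v, v⟫ + 1 / 2 * ⟪S v, v⟫ := by
  have h1 := hP.lower.inner_nonneg_left v
  rw [LinearMap.sub_apply, LinearMap.smul_apply, inner_sub_left, real_inner_smul_left] at h1
  linarith

theorem ProximalCondition.diagBlock_isPosDef (hP : P.ProximalCondition S D σ)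
    (hS : S.IsPositive) (i : Fin (m + 1)) : IsPosDef (P.diagBlock S D σ i) := by
  refine ⟨fun v w => ?_, fun v hv => ?_⟩
  · have h1 : ⟪v, block (P.curvature S σ) i i w⟫ = ⟪incl i v, P.curvature S σ (incl i w)⟫ := by
      rw [real_inner_comm, inner_block, real_inner_comm]
    rw [diagBlock, LinearMap.add_apply, LinearMap.add_apply, inner_add_left, inner_add_right,
      inner_block, h1, P.curvature_isSymmetric hS.isSymmetric, hP.symm i]
  · rw [inner_diagBlock]
    linarith [hP.inner_posDef i hv, hS.inner_nonneg_left (incl i v)]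

/-- The proximal operator of the block symmetric Gauss-Seidel iteration, in which `B` holds the
inverses of the diagonal blocks. -/
def sgsProx (P : Problem X Y Z) (S : PiLp 2 Y →ₗ[ℝ] PiLp 2 Y) (D B : ∀ i, Y i →ₗ[ℝ] Y i) (σ : ℝ) :
    PiLp 2 Y →ₗ[ℝ] PiLp 2 Y :=
  S + blockDiag D
    + upperPart (P.curvature S σ) ∘ₗ blockDiag B ∘ₗ lowerPart (P.curvature S σ)

theorem inner_sgsProx (hS : S.IsSymmetric) (B : ∀ i, Y i →ₗ[ℝ] Y i) (v w : PiLp 2 Y) :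
    ⟪P.sgsProx S D B σ v, w⟫ = ⟪S v, w⟫ + ⟪blockDiag D v, w⟫
      + ⟪blockDiag B (lowerPart (P.curvature S σ) v), lowerPart (P.curvature S σ) w⟫ := by
  rw [← inner_upperPart (P.curvature_isSymmetric hS σ), ← inner_add_left, ← inner_add_left]
  rfl

/-- The expression is a sum of three nonnegative forms. If it vanishes, then `L v = 0`, so `K` acts
on `v` as if block diagonal, and the remaining identities decouple into the blocks, where the
definiteness condition applies. -/
theorem ProximalCondition.sgsProx_pos (hP : P.ProximalCondition S D σ) (hS : S.IsPositive)
    (hσ : 0 < σ) {B : ∀ i, Y i →ₗ[ℝ] Y i} (hB : ∀ i, IsPosDef (B i)) {v : PiLp 2 Y} (hv : v ≠ 0) :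
    0 < ⟪P.sgsProx S D B σ v, v⟫ - 1 / 2 * ⟪S v, v⟫ + σ * ‖LinearMap.adjoint P.F v‖ ^ 2 := by
  set K := P.curvature S σ with hK
  set l := lowerPart K v with hl
  have hB0 : ∀ i, 0 ≤ ⟪B i (l i), l i⟫ := by
    intro i
    by_cases h : l i = 0
    · rw [h, inner_zero_right]
    · exact ((hB i).2 _ h).le
  have h1 := hP.inner_lower v
  have h2 : 0 ≤ σ * ‖LinearMap.adjoint P.F v‖ ^ 2 := mul_nonneg hσ.le (sq_nonneg _)
  have h3 : 0 ≤ ⟪blockDiag B l, l⟫ := by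
    rw [inner_blockDiag]
    exact Finset.sum_nonneg fun i _ => hB0 i
  rw [inner_sgsProx hS.isSymmetric]
  by_contra! hle
  have h4 : ⟪blockDiag B l, l⟫ = 0 := by linarith
  have h5 : l = 0 := by
    rw [inner_blockDiag, Finset.sum_eq_zero_iff_of_nonneg fun i _ => hB0 i] at h4
    ext i
    by_contra hne
    exact ((hB i).2 _ hne).ne' (h4 i (Finset.mem_univ i))
  have h6 : ⟪K v, v⟫ = ∑ i, ⟪block K i i (v i), v i⟫ := by
    have : K v = l + blockDiag (fun i => block K i i) v + upperPart K v := by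
      ext i
      rw [PiLp.add_apply, PiLp.add_apply, blockDiag_apply]
      exact map_apply_eq_parts K v i
    rw [this, inner_add_left, inner_add_left, inner_upperPart (P.curvature_isSymmetric
      hS.isSymmetric σ), ← hK, ← hl, h5, inner_zero_left, inner_zero_right, inner_blockDiag]
    ring
  -- Each `q i` is twice the nonnegative form of `D i + S_ii / 2` plus a penalty term. These sum to
  -- `⟪K v, v⟫ + 2 ⟪diag D v, v⟫`, which vanishes, so both parts vanish in every block.
  set q : Fin (m + 1) → ℝ := fun i => ⟪S (incl i (v i)), incl i (v i)⟫
    + σ * ‖LinearMap.adjoint P.F (incl i (v i))‖ ^ 2 + 2 * ⟪D i (v i), v i⟫ with hq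
  have hlow : ∀ i, 0 ≤ ⟪D i (v i), v i⟫ + 1 / 2 * ⟪S (incl i (v i)), incl i (v i)⟫ := by
    intro i
    have := hP.inner_lower (incl i (v i))
    rwa [blockDiag_incl, inner_incl_left, incl_apply_same] at this
  have hF0 : ∀ i, 0 ≤ σ * ‖LinearMap.adjoint P.F (incl i (v i))‖ ^ 2 :=
    fun i => mul_nonneg hσ.le (sq_nonneg _)
  have hq0 : ∀ i, 0 ≤ q i := fun i => by
    simp only [hq]
    linarith [hlow i, hF0 i]
  have hsum : ∑ i, q i = 0 := by
    have h7 : ∑ i, q i = ⟪K v, v⟫ + 2 * ⟪blockDiag D v, v⟫ := by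
      rw [h6, inner_blockDiag, Finset.mul_sum, ← Finset.sum_add_distrib]
      refine Finset.sum_congr rfl fun i _ => ?_
      rw [inner_block, hK, inner_curvature, real_inner_self_eq_norm_sq]
    rw [h7, hK, inner_curvature, real_inner_self_eq_norm_sq]
    linarith
  rw [Finset.sum_eq_zero_iff_of_nonneg fun i _ => hq0 i] at hsum
  apply hv
  ext i
  by_contra hne
  have h8 := hP.inner_posDef i hne
  have h9 : q i = 0 := hsum i (Finset.mem_univ i)
  simp only [hq] at h9
  linarith [hlow i, hF0 i]

variable {τ : ℝ} {ε : ℕ → ℝ} {x : ℕ → X} {y yh : ℕ → PiLp 2 Y} {z : ℕ → Z}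

theorem IsSGSiPADMM.mem_effDomain (h : P.IsSGSiPADMM S D σ τ ε x y yh z) (hS : S.IsSymmetric)
    (k : ℕ) : y k 0 ∈ effDomain P.p := by
  cases k with
  | zero => exact h.init
  | succ k =>
    obtain ⟨δ, -, hδ⟩ := h.step2 k 0
    exact P.mem_effDomain_of_mem_subdiff_majAug hS hδ

/-- The block symmetric Gauss-Seidel theorem: a backward sweep followed by a forward sweep amounts
to a simultaneous update of all blocks with an additional proximal term. -/
theorem IsSGSiPADMM.isInexactProxADMM (h : P.IsSGSiPADMM S D σ τ ε x y yh z)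
    (hS : S.IsSymmetric) {B : ∀ i, Y i →ₗ[ℝ] Y i}
    (hB : ∀ i v, B i (P.diagBlock S D σ i v) = v) :
    ∃ δ, P.IsInexactProxADMM (P.sgsProx S D B σ) σ τ ε δ x y z := by
  set K := P.curvature S σ with hK
  have hs1 : ∀ k i, ∃ δ : Y i, ‖δ‖ ≤ ε k ∧ (i ≠ 0 → δ - D i (yh k i - y k i) ∈
      subdiff (fun v => P.majAugLagrangian S σ (mix (y k) (yh k) i v) (z k) (x k) (y k))
        (yh k i)) := by
    intro k i
    by_cases hi : i = 0
    · exact ⟨0, by simpa using h.tol_nonneg k, fun hne => absurd hi hne⟩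
    · obtain ⟨δ, h1, h2⟩ := h.step1 k i hi
      exact ⟨δ, h1, fun _ => h2⟩
  choose δ' hδ'n hδ' using hs1
  choose δ hδn hδ using h.step2
  set e' : ℕ → PiLp 2 Y := fun k => WithLp.toLp 2 (δ' k) with he'
  set e : ℕ → PiLp 2 Y := fun k => WithLp.toLp 2 (δ k) with he
  have hnorm : ∀ k, ‖e k‖ ≤ (m + 1) * ε k := by
    intro k
    refine (norm_le_sum_norm _).trans ((Finset.sum_le_sum fun i _ => hδn k i).trans_eq ?_)
    simp
  have hnorm' : ∀ k, ‖e' k‖ ≤ (m + 1) * ε k := by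
    intro k
    refine (norm_le_sum_norm _).trans ((Finset.sum_le_sum fun i _ => hδ'n k i).trans_eq ?_)
    simp
  set C := LinearMap.toContinuousLinearMap (upperPart K ∘ₗ blockDiag B) with hC
  refine ⟨fun k => e k - upperPart K (blockDiag B (e' k - e k)),
    h.tol_nonneg, h.tol_summable, ?_, fun k => ?_, h.step3, h.step4⟩
  · refine Summable.of_nonneg_of_le (fun _ => norm_nonneg _) (fun k => ?_)
      (h.tol_summable.mul_left ((m + 1) + ‖C‖ * (2 * (m + 1))))
    have h1 : ‖upperPart K (blockDiag B (e' k - e k))‖ ≤ ‖C‖ * ‖e' k - e k‖ := C.le_opNorm _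
    have h2 : ‖e' k - e k‖ ≤ 2 * (m + 1) * ε k := by
      linarith [norm_sub_le (e' k) (e k), hnorm k, hnorm' k]
    have h3 : ‖C‖ * ‖e' k - e k‖ ≤ ‖C‖ * (2 * (m + 1) * ε k) := by gcongr
    refine (norm_sub_le _ _).trans ?_
    linarith [hnorm k]
  set a := y (k + 1) - y k with ha
  set a' := yh k - y k with ha'
  set g := P.smoothGrad S σ (z k) (x k) (y k) (y k) with hg
  have hmix : ∀ (c : PiLp 2 Y) (i : Fin (m + 1)) (v : Y i),
      P.smoothGrad S σ (z k) (x k) (y k) (mix c (yh k) i v) i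
        = g i + (lowerPart K (c - y k) i + block K i i (v - y k i) + upperPart K a' i) := by
    intro c i v
    rw [smoothGrad_eq, mix_sub, PiLp.add_apply, ← curvature, map_mix_apply]
  have hstep1 : ∀ i, i ≠ 0 → δ' k i = g i + upperPart K a' i + P.diagBlock S D σ i (a' i) := by
    intro i hi
    have h1 := P.eq_smoothGrad_of_mem_subdiff hS (h.mem_effDomain hS k) hi (hδ' k i hi)
    rw [hmix, sub_self, map_zero] at h1
    rw [eq_add_of_sub_eq h1, diagBlock, LinearMap.add_apply, ha', PiLp.sub_apply, ← hK,
      PiLp.zero_apply]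
    abel
  have hstep2 : ∀ i, i ≠ 0 → δ k i
      = g i + lowerPart K a i + upperPart K a' i + P.diagBlock S D σ i (a i) := by
    intro i hi
    have h1 := P.eq_smoothGrad_of_mem_subdiff hS (h.mem_effDomain hS (k + 1)) hi (hδ k i)
    rw [hmix] at h1
    rw [eq_add_of_sub_eq h1, diagBlock, LinearMap.add_apply, ha, PiLp.sub_apply, ← hK]
    abel
  have hstep3 : δ k 0 - (g 0 + lowerPart K a 0 + upperPart K a' 0 + P.diagBlock S D σ 0 (a 0))
      ∈ subdiff P.p (y (k + 1) 0) := by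
    have h1 := P.sub_smoothGrad_mem_subdiff hS (hδ k 0)
    rw [hmix] at h1
    convert h1 using 1
    rw [diagBlock, LinearMap.add_apply, ha, PiLp.sub_apply, ← hK]
    abel
  -- The two sweeps differ only by the lower part and the errors, so subtracting their conditions
  -- gives `a' = a + B (L a + e' - e)` off block `0`. Substitution produces both the proximal term
  -- `U B L` and the correction to the error.
  have hU : upperPart K a' = upperPart K (a + blockDiag B (lowerPart K a + (e' k - e k))) := by
    apply upperPart_congr
    intro i hi
    have h1 : lowerPart K a i + (δ' k i - δ k i) = P.diagBlock S D σ i (a' i - a i) := by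
      rw [hstep1 i hi, hstep2 i hi, map_sub (P.diagBlock S D σ i)]
      abel
    rw [PiLp.add_apply, blockDiag_apply]
    change a' i = a i + B i (lowerPart K a i + (δ' k i - δ k i))
    rw [h1, hB]
    abel
  have hKa : ∀ i, lowerPart K a i + P.diagBlock S D σ i (a i) + upperPart K a i
      = (K a + blockDiag D a) i := by
    intro i
    rw [PiLp.add_apply, blockDiag_apply, map_apply_eq_parts K a i, diagBlock, LinearMap.add_apply]
    abel
  have hfin : ∀ i, (e k - upperPart K (blockDiag B (e' k - e k)) - ∇ P.f (y k) - P.F (x k)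
      - σ • P.F (P.residual (y (k + 1)) (z k)) - P.sgsProx S D B σ a) i
      = δ k i - (g i + lowerPart K a i + upperPart K a' i + P.diagBlock S D σ i (a i)) := by
    intro i
    -- The part `σ F F* a` of `K a` moves the residual from `y k` to `y (k + 1)`; `S a` stays as a
    -- proximal term.
    have h1 : g + (K a + blockDiag D a) = ∇ P.f (y k) + P.F (x k)
        + σ • P.F (P.residual (y (k + 1)) (z k)) + (S a + blockDiag D a) := by
      have h2 := P.smoothGrad_eq S σ (z k) (x k) (y k) (y (k + 1))
      rw [← curvature, ← hK, ← ha, ← hg] at h2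
      rw [← add_assoc, ← h2, smoothGrad, ← ha]
      abel
    have h3 : e k - upperPart K (blockDiag B (e' k - e k)) - ∇ P.f (y k) - P.F (x k)
        - σ • P.F (P.residual (y (k + 1)) (z k)) - P.sgsProx S D B σ a
        = e k - (g + (K a + blockDiag D a)
          + (upperPart K a' - upperPart K a)) := by
      rw [h1, hU, sgsProx]
      simp only [LinearMap.add_apply, LinearMap.comp_apply, map_add, ← hK]
      module
    rw [h3, PiLp.sub_apply, PiLp.add_apply, PiLp.add_apply, ← hKa]
    change δ k i - (g i + (lowerPart K a i + P.diagBlock S D σ i (a i) + upperPart K a i)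
      + (upperPart K a' i - upperPart K a i)) = _
    abel
  refine ⟨?_, fun i hi => ?_⟩
  · rw [hfin]
    exact hstep3
  · rw [hfin, ← hstep2 i hi, sub_self]

theorem blockSubdiff_mono_zero {v g v' g' : PiLp 2 Y} (hg : g ∈ P.blockSubdiff v)
    (hg' : g' ∈ P.blockSubdiff v') : 0 * ‖v - v'‖ ^ 2 ≤ ⟪g - g', v - v'⟫ :=
  P.blockSubdiff_mono le_rfl
    (subdiff_strongly_monotone P.p_closedProperConvex.ne_bot P.p_closedProperConvex.proper
      (strongConvexOn_zero.2 P.p_closedProperConvex.convex)) (Or.inl rfl) hg hg'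

theorem IsSGSiPADMM.exists_isInexactProxADMM (h : P.IsSGSiPADMM S D σ τ ε x y yh z)
    (hS : P.IsMajorizing S) (hσ : 0 < σ) (hτ : 0 < τ) (hτ2 : τ < 2)
    (hP : P.ProximalCondition S D σ) :
    ∃ N δ, P.IsInexactProxADMM N σ τ ε δ x y z ∧ P.IsAdmissible S N σ τ 0 := by
  choose B hB hBs hBp using fun i => (hP.diagBlock_isPosDef hS.1 i).exists_inverse
  obtain ⟨δ, hδ⟩ := h.isInexactProxADMM hS.1.isSymmetric hB
  have hB0 : ∀ l : PiLp 2 Y, 0 ≤ ⟪blockDiag B l, l⟫ := by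
    intro l
    rw [inner_blockDiag]
    refine Finset.sum_nonneg fun i _ => ?_
    by_cases hl : l i = 0
    · rw [hl, inner_zero_right]
    · exact ((hBp i).2 _ hl).le
  refine ⟨_, δ, hδ,
    { σ_pos := hσ
      τ_pos := hτ
      τ_lt := hτ2
      μ_nonneg := le_rfl
      major := hS
      N_symm := fun v w => ?_
      N_nonneg := fun v => ?_
      pos := fun v hv => ?_
      mono := blockSubdiff_mono_zero }⟩
  · rw [real_inner_comm (P.sgsProx S D B σ w), inner_sgsProx hS.1.isSymmetric,
      inner_sgsProx hS.1.isSymmetric, hS.1.isSymmetric v w, blockDiag_isSymmetric hP.symm v w,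
      blockDiag_isSymmetric hBs, real_inner_comm v, real_inner_comm v,
      real_inner_comm (lowerPart (P.curvature S σ) v)]
  · rw [real_inner_comm, inner_sgsProx hS.1.isSymmetric, real_inner_comm (S v) v]
    linarith [hP.inner_lower v, hB0 (lowerPart (P.curvature S σ) v)]
  · have h1 := hP.sgsProx_pos hS.1 hσ hBp hv
    rw [real_inner_comm, real_inner_comm (S v) v]
    linarith

end Problem

/-! ### The two-block case. -/

namespace Problem

section TwoBlock

variable {X : Type*} {Y : Fin (0 + 1) → Type*} {Z : Type*}
  [NormedAddCommGroup X] [InnerProductSpace ℝ X] [FiniteDimensional ℝ X]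
  [∀ i, NormedAddCommGroup (Y i)] [∀ i, InnerProductSpace ℝ (Y i)]
  [∀ i, FiniteDimensional ℝ (Y i)]
  [NormedAddCommGroup Z] [InnerProductSpace ℝ Z] [FiniteDimensional ℝ Z]
  {P : Problem X Y Z} {σ τ : ℝ} {ε : ℕ → ℝ} {x : ℕ → X} {y yh : ℕ → PiLp 2 Y} {z : ℕ → Z}

theorem mix_zero_eq (a b c : PiLp 2 Y) : mix a b 0 (c 0) = c := by
  ext i
  rw [Fin.fin_one_eq_zero i, mix_apply_same]

theorem gradient_f_eq_zero (hf : P.f = 0) (v : PiLp 2 Y) : ∇ P.f v = 0 := by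
  rw [hf]
  exact gradient_const v 0

theorem fHat_zero (hf : P.f = 0) (v v' : PiLp 2 Y) : P.fHat 0 v v' = 0 := by
  rw [fHat, gradient_f_eq_zero hf, hf]
  simp

theorem majAugLagrangian_zero (hf : P.f = 0) (v v' : PiLp 2 Y) (w : Z) (u : X) :
    P.majAugLagrangian 0 σ v w u v' = P.augLagrangian σ v w u := by
  rw [majAugLagrangian, augLagrangian, fHat_zero hf, hf, real_inner_comm u]
  rfl

theorem isMajorizing_zero (hf : P.f = 0) : P.IsMajorizing 0 := by
  refine ⟨LinearMap.isPositive_zero, fun v v' => ?_⟩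
  rw [fHat_zero hf, hf]
  exact le_rfl

theorem isInexactProxADMM_of_subdiff (hε : ∀ k, 0 ≤ ε k) (hs : Summable ε)
    (hy : ∀ k, ∃ δ : Y 0, ‖δ‖ ≤ ε k ∧
      δ ∈ subdiff (fun v => P.majAugLagrangian 0 σ (mix (y (k + 1)) (yh k) 0 v) (z k) (x k) (y k))
        (y (k + 1) 0))
    (hz : ∀ k, ‖P.G (x k) - P.b + σ • P.G (P.residual (y (k + 1)) (z (k + 1)))‖ ≤ ε k)
    (hx : ∀ k, x (k + 1) = x k + (τ * σ) • P.residual (y (k + 1)) (z (k + 1))) :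
    ∃ δ, P.IsInexactProxADMM 0 σ τ ε δ x y z := by
  choose δ hδn hδ using hy
  refine ⟨fun k => incl 0 (δ k), hε, hs, ?_, fun k => ⟨?_, fun i hi => ?_⟩, hz, hx⟩
  · simp only [norm_incl]
    exact Summable.of_nonneg_of_le (fun _ => norm_nonneg _) hδn hs
  · have h1 := P.sub_smoothGrad_mem_subdiff LinearMap.IsSymmetric.zero (hδ k)
    rw [mix_zero_eq] at h1
    have h2 : incl 0 (δ k) - ∇ P.f (y k) - P.F (x k)
        - σ • P.F (P.residual (y (k + 1)) (z k)) - (0 : PiLp 2 Y →ₗ[ℝ] PiLp 2 Y) (y (k + 1) - y k)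
        = incl 0 (δ k) - P.smoothGrad 0 σ (z k) (x k) (y k) (y (k + 1)) := by
      rw [smoothGrad, LinearMap.zero_apply]
      abel
    rw [h2, PiLp.sub_apply, incl_apply_same]
    exact h1
  · exact absurd (Fin.fin_one_eq_zero i) hi

theorem IsClassicADMM.isInexactProxADMM (h : P.IsClassicADMM σ τ x y z) (hf : P.f = 0) :
    ∃ ε δ, P.IsInexactProxADMM 0 σ τ ε δ x y z := by
  have hb := P.p_closedProperConvex.ne_bot
  refine ⟨fun _ => 0, isInexactProxADMM_of_subdiff (yh := y) (fun _ => le_rfl) summable_zero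
    (fun k => ⟨0, by rw [norm_zero], fun v => ?_⟩) (fun k => ?_) h.step_x⟩
  · beta_reduce
    rw [inner_zero_left, EReal.coe_zero, add_zero, majAugLagrangian_zero hf,
      majAugLagrangian_zero hf, mix_zero_eq]
    exact h.step_y k _
  -- Finiteness of `p` at the minimizer allows it to be cancelled when values at different `z` are
  -- compared.
  · have hdom : y (k + 1) 0 ∈ effDomain P.p := by
      obtain ⟨v, hv⟩ := P.p_closedProperConvex.proper
      intro htop
      have h1 := h.step_y k (incl 0 v)
      rw [augLagrangian, augLagrangian, htop, EReal.top_add_coe, top_le_iff, incl_apply_same,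
        ← coe_toReal_of_mem_effDomain hb hv, ← EReal.coe_add] at h1
      exact EReal.coe_ne_top _ h1
    set r := P.residual (y (k + 1)) (z (k + 1)) with hr
    set d := P.G (x k) - P.b + σ • P.G r with hd
    -- The vector `d` is the gradient in `z` of the augmented Lagrangian at the minimizer. Comparing
    -- with the point displaced by `-t d` and dividing by `t` forces `d = 0`, so the `z`-step holds
    -- with tolerance zero.
    have h1 : ∀ t : ℝ, 0 < t → t < 1 →
        ‖d‖ ^ 2 ≤ 0 + t * (σ / 2 * ‖LinearMap.adjoint P.G d‖ ^ 2) := by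
      intro t ht _
      have h2 := h.step_z k (z (k + 1) + (-t) • d)
      have h3 : P.residual (y (k + 1)) (z (k + 1) + (-t) • d)
          = r + (-t) • LinearMap.adjoint P.G d := by
        rw [hr, residual, residual, map_add, map_smul]
        abel
      rw [augLagrangian, augLagrangian, h3, ← hr, ← coe_toReal_of_mem_effDomain hb hdom,
        ← EReal.coe_add, ← EReal.coe_add, EReal.coe_le_coe_iff, norm_add_sq_real, norm_smul,
        mul_pow, Real.norm_eq_abs, sq_abs, inner_add_right, inner_add_right, inner_smul_right,
        inner_smul_right, inner_smul_right, LinearMap.adjoint_inner_right,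
        LinearMap.adjoint_inner_right] at h2
      have h4 : ‖d‖ ^ 2 = ⟪P.G (x k), d⟫ - ⟪P.b, d⟫ + σ * ⟪P.G r, d⟫ := by
        rw [← real_inner_self_eq_norm_sq, ← real_inner_smul_left, ← inner_sub_left,
          ← inner_add_left]
      have h5 : t * ‖d‖ ^ 2 ≤ t * (t * (σ / 2 * ‖LinearMap.adjoint P.G d‖ ^ 2)) := by
        rw [h4]
        linarith
      rw [zero_add]
      exact le_of_mul_le_mul_left h5 ht
    have h2 := le_of_forall_le_add_mul h1
    have h3 : ‖d‖ = 0 := pow_eq_zero_iff two_ne_zero |>.1 (le_antisymm h2 (sq_nonneg _))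
    exact h3.le

/-- Without a proximal term, definiteness comes from injectivity of `F*` when `F` is surjective,
with `μ = 0`, or else from the modulus of strong convexity. -/
theorem exists_isAdmissible (hf : P.f = 0) (hσ : 0 < σ) (hτ : 0 < τ) (hτ2 : τ < 2)
    (h : Function.Surjective P.F ∨ IsStronglyConvex P.p) : ∃ μ, P.IsAdmissible 0 0 σ τ μ := by
  have hb := P.p_closedProperConvex.ne_bot
  rcases h with hF | ⟨μ, hμ, hp⟩
  · refine ⟨0,
      { σ_pos := hσ
        τ_pos := hτ
        τ_lt := hτ2
        μ_nonneg := le_rfl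
        major := isMajorizing_zero hf
        N_symm := LinearMap.IsSymmetric.zero
        N_nonneg := fun v => by simp
        pos := fun v hv => ?_
        mono := blockSubdiff_mono_zero }⟩
    have h1 : LinearMap.adjoint P.F v ≠ 0 := by
      intro h0
      obtain ⟨u, rfl⟩ := hF v
      apply hv
      rw [← inner_self_eq_zero (𝕜 := ℝ), ← LinearMap.adjoint_inner_left, h0, inner_zero_left]
    have h2 : 0 < σ * ‖LinearMap.adjoint P.F v‖ ^ 2 := by positivity
    simpa using h2
  · refine ⟨μ,
      { σ_pos := hσ
        τ_pos := hτ
        τ_lt := hτ2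
        μ_nonneg := hμ.le
        major := isMajorizing_zero hf
        N_symm := LinearMap.IsSymmetric.zero
        N_nonneg := fun v => by simp
        pos := fun v hv => ?_
        mono := fun hg hg' => P.blockSubdiff_mono hμ.le
          (subdiff_strongly_monotone hb P.p_closedProperConvex.proper hp) (Or.inr rfl) hg hg' }⟩
    have h2 : 0 < μ * ‖v‖ ^ 2 := by positivity
    have h3 : 0 ≤ σ * ‖LinearMap.adjoint P.F v‖ ^ 2 := by positivity
    simp only [LinearMap.zero_apply, inner_zero_right]
    linarith

end TwoBlock

end Problem

end SGSADMM

end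

/-! ### The convergence theorem: both cases reduce to the inexact proximal ADMM. -/

theorem mainTheorem1 {X Z : Type*}
    [NormedAddCommGroup X] [InnerProductSpace ℝ X] [FiniteDimensional ℝ X]
    [NormedAddCommGroup Z] [InnerProductSpace ℝ Z] [FiniteDimensional ℝ Z] :
    -- the multi-block problem with `m + 1` blocks
    (∀ (m : ℕ) (Y : Fin (m + 1) → Type*)
        [∀ i, NormedAddCommGroup (Y i)] [∀ i, InnerProductSpace ℝ (Y i)]
        [∀ i, FiniteDimensional ℝ (Y i)]
        (P : SGSADMM.Problem X Y Z) (S : PiLp 2 Y →ₗ[ℝ] PiLp 2 Y) (D : ∀ i, Y i →ₗ[ℝ] Y i)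
        (σ τ : ℝ) (ε : ℕ → ℝ) (x : ℕ → X) (y yh : ℕ → PiLp 2 Y) (z : ℕ → Z),
        P.IsMajorizing S → 0 < σ → 0 < τ → τ < 2 →
        P.kktSet.Nonempty →
        P.ProximalCondition S D σ →
        P.IsSGSiPADMM S D σ τ ε x y yh z →
        -- convergence to a KKT point, with primal and dual optimality of the limit
        (∃ (x' : X) (y' : PiLp 2 Y) (z' : Z),
          Tendsto (fun k => (x k, y k, P.projRange (z k))) atTop (𝓝 (x', y', z')) ∧
          P.IsKKT x' y' z' ∧ P.IsSolution y' z' ∧ P.IsDualSolution x') ∧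
        -- accumulation points of `(y k, z k)`
        (∀ (y' : PiLp 2 Y) (z' : Z),
          MapClusterPt (y', z') atTop (fun k => (y k, z k)) → P.IsSolution y' z') ∧
        -- objective values and feasibility
        Tendsto (fun k => P.objective (y k) (z k)) atTop (𝓝 P.optValue) ∧
        Tendsto (fun k => P.residual (y k) (z k)) atTop (𝓝 0) ∧
        -- distance to the KKT set
        Tendsto (fun k => Metric.infDist (SGSADMM.Problem.triple (x k) (y k) (z k)) P.kktSet)
          atTop (𝓝 0) ∧
        -- convergence of the whole sequence
        (Function.Surjective P.G →
          ∃ (x' : X) (y' : PiLp 2 Y) (z' : Z),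
            Tendsto (fun k => (x k, y k, z k)) atTop (𝓝 (x', y', z')) ∧ P.IsKKT x' y' z')) ∧
    -- the two-block problem `min { p y - ⟪b, z⟫ | F* y + G* z = c }`: one `y`-block and `f = 0`
    (∀ (Y : Fin (0 + 1) → Type*)
        [∀ i, NormedAddCommGroup (Y i)] [∀ i, InnerProductSpace ℝ (Y i)]
        [∀ i, FiniteDimensional ℝ (Y i)]
        (P : SGSADMM.Problem X Y Z)
        (σ τ : ℝ) (x : ℕ → X) (y : ℕ → PiLp 2 Y) (z : ℕ → Z),
        P.f = 0 → 0 < σ → 0 < τ → τ < 2 →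
        P.kktSet.Nonempty →
        (Function.Surjective P.F ∨ SGSADMM.IsStronglyConvex P.p) →
        -- the classic ADMM, or its inexact variant without proximal terms
        (P.IsClassicADMM σ τ x y z ∨
          ∃ (ε : ℕ → ℝ) (yh : ℕ → PiLp 2 Y), P.IsSGSiPADMM 0 0 σ τ ε x y yh z) →
        (∃ (x' : X) (y' : PiLp 2 Y) (z' : Z),
          Tendsto (fun k => (x k, y k, P.projRange (z k))) atTop (𝓝 (x', y', z')) ∧
          P.IsKKT x' y' z' ∧ P.IsSolution y' z' ∧ P.IsDualSolution x') ∧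
        Tendsto (fun k => Metric.infDist (SGSADMM.Problem.triple (x k) (y k) (z k)) P.kktSet)
          atTop (𝓝 0) ∧
        (Function.Surjective P.G →
          ∃ (x' : X) (y' : PiLp 2 Y) (z' : Z),
            Tendsto (fun k => (x k, y k, z k)) atTop (𝓝 (x', y', z')) ∧ P.IsKKT x' y' z')) := by
  constructor
  · intro m Y _ _ _ P S D σ τ ε x y yh z hS hσ hτ hτ2 hne hP h
    obtain ⟨N, δ, hN, hA⟩ := h.exists_isInexactProxADMM hS hσ hτ hτ2 hP
    exact hN.convergence hA hne
  · intro Y _ _ _ P σ τ x y z hf hσ hτ hτ2 hne hFp h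
    obtain ⟨μ, hA⟩ := SGSADMM.Problem.exists_isAdmissible hf hσ hτ hτ2 hFp
    have hN : ∃ ε δ, P.IsInexactProxADMM 0 σ τ ε δ x y z := by
      rcases h with h | ⟨ε, yh, h⟩
      · exact h.isInexactProxADMM hf
      · refine ⟨ε, SGSADMM.Problem.isInexactProxADMM_of_subdiff (yh := yh) h.tol_nonneg
          h.tol_summable (fun k => ?_) h.step3 h.step4⟩
        obtain ⟨δ, h1, h2⟩ := h.step2 k 0
        refine ⟨δ, h1, ?_⟩
        simpa using h2
    obtain ⟨ε, δ, hN⟩ := hN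
    obtain ⟨h1, -, -, -, h5, h6⟩ := hN.convergence hA hne
    exact ⟨h1, h5, h6⟩
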